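/- Let $\tilde A$ be an abelian group with subgroups $A_0\subset A\subset\tilde A$. Let $V=\coprod_{n\in\mathbb Z,\ \alpha\in A}V^{(\alpha)}_{(n)}$ be a strongly $A$-graded conformal vertex algebra, and let $V_0\subset V$ be a vertex subalgebra, with the same vacuum and conformal vector, that is strongly graded with respect to $A_0$, i.e. $V_0=\coprod_{\alpha\in A_0,\ n\in\mathbb Z}V_0\cap V^{(\alpha)}_{(n)}$. Let $W_0,\dots,W_4$ be strongly $\tilde A$-graded generalized $V$-modules, $W_i=\coprod_{n\in\mathbb C,\ \beta\in\tilde A}(W_i)^{(\beta)}_{[n]}$, where $[n]$ denotes generalized $L(0)$-weight $n$, and let $W_0'$ be the contragredient of $W_0$. Assume that each $W=W_0,W_1,W_2,W_3$ * has only real generalized weights; * is lower bounded: for each $\beta\in\tilde A$, $W^{(\beta)}_{[n]}=0$ when $\Re(n)$ is sufficiently negative; * is $C_1$-cofinite as a $V_0$-module: $\dim W^{(\beta)}/(C_1(W)\cap W^{(\beta)})<\infty$ for each $\beta\in\tilde A$, where $C_1(W)$ is the span of all $u_{-1}w$ with $w\in W$ and $u\in\coprod_{n>0}(V_0\cap V_{(n)})$.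 For strongly $\tilde A$-graded generalized modules $M_1,M_2,M_3$ let $N_{M_1^{(\gamma_1)}M_2^{(\gamma_2)}}^{M_3^{(\gamma_1+\gamma_2)}}$ be the dimension of the space of logarithmic intertwining operators of type $\binom{M_3^{(\gamma_1+\gamma_2)}}{M_1^{(\gamma_1)}\,M_2^{(\gamma_2)}}$ among these homogeneous components, regarded as $V^{(0)}$-modules. Assume that for $(M_1,M_2,M_3)=(W_1,W_4,W_0')$ and for $(M_1,M_2,M_3)=(W_2,W_3,W_4)$, and for all $\beta_1,\beta_2\in\tilde A$, this fusion rule is nonzero for only finitely many pairs $(\gamma_1,\gamma_2)\in(\beta_1+A_0)\times(\beta_2+A_0)$. (If every strongly $\tilde A$-graded generalized $V$-module is real-graded, lower bounded and $C_1$-cofinite over $V_0$, and every triple of such modules satisfies this finiteness condition, then all these assumptions hold for all choices of the $W_i$.) Let $\mathcal Y_1,\mathcal Y_2$ be grading-compatible logarithmic intertwining operators of types $\binom{W_0'}{W_1\,W_4}$ and $\binom{W_4}{W_2\,W_3}$, and let $w_i\in W_i$ $(i=0,1,2,3)$ be $\tilde A$-homogeneous. Then there are integers $m,n\ge1$ and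 elements $a_1,\dots,a_m,b_1,\dots,b_n$ of $\mathbb C[z_1^{\pm1},z_2^{\pm1},(z_1-z_2)^{-1}]$ such that the formal series $$\varphi=\langle w_0,\mathcal Y_1(w_1,z_1)\mathcal Y_2(w_2,z_2)w_3\rangle$$ in complex powers of $z_1,z_2$ and nonnegative integral powers of $\log z_1,\log z_2$ satisfies $$\frac{\partial^m\varphi}{\partial z_1^m}+a_1\frac{\partial^{m-1}\varphi}{\partial z_1^{m-1}}+\dots+a_m\varphi=0,\qquad \frac{\partial^n\varphi}{\partial z_2^n}+b_1\frac{\partial^{n-1}\varphi}{\partial z_2^{n-1}}+\dots+b_n\varphi=0,$$ where the coefficients are replaced by their expansions in the region $|z_1|>|z_2|>0$ (so $(z_1-z_2)^{-1}=\sum_{k\ge0}z_1^{-1-k}z_2^k$), and all the resulting products of series are well defined. -/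

import Mathlib

namespace VertexAlg

noncomputable section

/-! ## Vertex operators in components

`Y(u, x)w = ∑_{n ∈ ℤ} (u_n w) x^{-n-1}` is recorded by its modes `Y n u w = u_n w`. -/

/-- The modes of a linear map `U → (End W)[[x, x⁻¹]]`: `Y n u w` is `u_n w`. -/
abbrev Modes (U W : Type*) [AddCommGroup U] [Module ℂ U] [AddCommGroup W] [Module ℂ W] :=
  ℤ → U →ₗ[ℂ] W →ₗ[ℂ] W

section Axioms

variable {U W W₁ W₂ W₃ : Type*} [AddCommGroup U] [Module ℂ U] [AddCommGroup W] [Module ℂ W]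
  [AddCommGroup W₁] [Module ℂ W₁] [AddCommGroup W₂] [Module ℂ W₂] [AddCommGroup W₃] [Module ℂ W₃]

/-- `L(n) = ω_{n+1}`. -/
def vir (Y : Modes U W) (ω : U) (n : ℤ) : W →ₗ[ℂ] W := Y (n + 1) ω

/-- For all `u`, `w`: `u_n w = 0` for `n` sufficiently large. -/
def LowerTruncation (Y : Modes U W) : Prop :=
  ∀ u w, ∃ N : ℤ, ∀ n ≥ N, Y n u w = 0

/-- The Jacobi identity
`x₀⁻¹δ((x₁-x₂)/x₀) Y₃(u,x₁)Z(w₁,x₂)w₂ - x₀⁻¹δ((x₂-x₁)/(-x₀)) Z(w₁,x₂)Y₂(u,x₁)w₂`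
`= x₂⁻¹δ((x₁-x₀)/x₂) Z(Y₁(u,x₀)w₁,x₂)w₂`,
written as the equality of the coefficients of `x₀^{-l-1} x₁^{-m-1} x₂^{-n-1}` for all
`l, m ∈ ℤ` and all exponents `n` of `Z(w₁,x₂)w₂ = ∑_n (Z n w₁ w₂) x₂^{-n-1}`; here `n` ranges over
`I = ℤ` or `I = ℂ`. All three sums are finite by the lower truncation conditions that accompany
this identity wherever it is used. -/
def JacobiIdentity {I : Type*} [AddGroupWithOne I] (Y₁ : Modes U W₁) (Y₂ : Modes U W₂)
    (Y₃ : Modes U W₃) (Z : I → W₁ →ₗ[ℂ] W₂ →ₗ[ℂ] W₃) : Prop :=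
  ∀ (u : U) (w₁ : W₁) (w₂ : W₂) (l m : ℤ) (n : I),
    (∑ᶠ i : ℕ, ((-1) ^ i * Ring.choose l i : ℤ) •
        Y₃ (m + l - i) u (Z (n + (i : I)) w₁ w₂))
      - (∑ᶠ i : ℕ, ((l.negOnePow : ℤ) * (-1) ^ i * Ring.choose l i : ℤ) •
        Z (n + (l : I) - (i : I)) w₁ (Y₂ (m + i) u w₂))
      = ∑ᶠ i : ℕ, (Ring.choose m i : ℤ) •
        Z (n + (m : I) - (i : I)) (Y₁ (l + i) u w₁) w₂

/-- `[L(m), L(n)] = (m-n) L(m+n) + (m³-m)/12 δ_{m+n,0} c`. -/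
def VirasoroRelations (Y : Modes U W) (ω : U) (c : ℂ) : Prop :=
  ∀ (m n : ℤ) (w : W),
    vir Y ω m (vir Y ω n w) - vir Y ω n (vir Y ω m w)
      = ((m : ℂ) - n) • vir Y ω (m + n) w
        + (if m + n = 0 then (((m : ℂ) ^ 3 - m) / 12 * c) else 0) • w

/-- `d/dx Y(v, x) = Y(L(-1)v, x)`. -/
def DerivativeProperty (YU : Modes U U) (Y : Modes U W) (ω : U) : Prop :=
  ∀ (v : U) (n : ℤ) (w : W), Y n (vir YU ω (-1) v) w = (-(n : ℂ)) • Y (n - 1) v w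

end Axioms

/-! ## Strongly graded conformal vertex algebras -/

/-- A conformal vertex algebra `(V, Y, 𝟏, ω)` with central charge `c`. The direct sum
decomposition `V = ∐ V_(n)` is expressed by independence and spanning. -/
structure ConformalVertexAlgebra (V : Type*) [AddCommGroup V] [Module ℂ V] where
  Y : Modes V V
  vac : V
  ω : V
  c : ℂ
  /-- `wt n` is the weight space `V_(n)`. -/
  wt : ℤ → Submodule ℂ V
  wt_indep : iSupIndep wt
  wt_span : ⨆ n, wt n = ⊤
  vac_mem : vac ∈ wt 0
  ω_mem : ω ∈ wt 2
  lower_truncation : LowerTruncation Y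
  vacuum : ∀ (n : ℤ) (v : V), Y n vac v = if n = -1 then v else 0
  creation : ∀ v : V, (∀ n : ℤ, 0 ≤ n → Y n v vac = 0) ∧ Y (-1) v vac = v
  jacobi : JacobiIdentity Y Y Y Y
  virasoro : VirasoroRelations Y ω c
  derivative : DerivativeProperty Y Y ω
  L_zero : ∀ (n : ℤ), ∀ v ∈ wt n, vir Y ω 0 v = (n : ℂ) • v

/-- A strongly `A`-graded conformal vertex algebra. -/
structure StronglyGradedCVA (A : Type*) [AddCommGroup A] (V : Type*) [AddCommGroup V]
    [Module ℂ V] extends ConformalVertexAlgebra V where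
  /-- `gr α` is the `A`-homogeneous subspace `V^(α)`. -/
  gr : A → Submodule ℂ V
  gr_indep : iSupIndep gr
  gr_span : ⨆ α, gr α = ⊤
  gr_compatible : ∀ α, gr α = ⨆ n, wt n ⊓ gr α
  gr_lower : ∀ α, ∃ N : ℤ, ∀ n < N, wt n ⊓ gr α = ⊥
  gr_finite : ∀ α n, Module.Finite ℂ ↥(wt n ⊓ gr α)
  vac_mem_gr : vac ∈ gr 0
  ω_mem_gr : ω ∈ gr 0
  gr_Y : ∀ (α β : A) (n : ℤ), ∀ v ∈ gr α, ∀ w ∈ gr β, Y n v w ∈ gr (α + β)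

/-! ## Strongly graded generalized modules

Throughout, `At` is the abelian group `Ã` and `A` is a subgroup of it. -/

section Modules

variable {At : Type*} [AddCommGroup At] {A : AddSubgroup At}
  {V : Type*} [AddCommGroup V] [Module ℂ V]

/-- An action of the modes of `V` on `W` together with a family of subspaces `W^(β)`, `β ∈ Ã`,
such that `v_n W^(β) ⊆ W^(α+β)` for `v ∈ V^(α)`. This is the part of a strongly graded generalized
module that the notions of logarithmic intertwining operator and fusion rule refer to. -/
structure GradedAction (𝒱 : StronglyGradedCVA A V) (W : Type*) [AddCommGroup W]
    [Module ℂ W] where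
  Y : Modes V W
  /-- `gr β` is the `Ã`-homogeneous subspace `W^(β)`. -/
  gr : At → Submodule ℂ W
  gr_Y : ∀ (α : A) (β : At) (n : ℤ), ∀ v ∈ 𝒱.gr α, ∀ w ∈ gr β, Y n v w ∈ gr ((α : At) + β)

/-- A strongly `Ã`-graded generalized `V`-module. -/
structure StronglyGradedGenModule (𝒱 : StronglyGradedCVA A V) (W : Type*) [AddCommGroup W]
    [Module ℂ W] extends GradedAction 𝒱 W where
  /-- `wt n` is the generalized weight space `W_[n]`. -/
  wt : ℂ → Submodule ℂ W
  wt_indep : iSupIndep wt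
  wt_span : ⨆ n, wt n = ⊤
  lower_truncation : LowerTruncation Y
  vacuum : ∀ (n : ℤ) (w : W), Y n 𝒱.vac w = if n = -1 then w else 0
  jacobi : JacobiIdentity 𝒱.Y Y Y Y
  virasoro : VirasoroRelations Y 𝒱.ω 𝒱.c
  derivative : DerivativeProperty 𝒱.Y Y 𝒱.ω
  L_zero : ∀ (n : ℂ), ∀ w ∈ wt n,
    ∃ k : ℕ, ((vir Y 𝒱.ω 0 - n • (LinearMap.id : W →ₗ[ℂ] W)) ^ k) w = 0
  gr_indep : iSupIndep gr
  gr_span : ⨆ β, gr β = ⊤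
  gr_compatible : ∀ β, gr β = ⨆ n, wt n ⊓ gr β
  gr_lower : ∀ (β : At) (n : ℂ), ∃ N : ℤ, ∀ k < N, wt (n + k) ⊓ gr β = ⊥
  gr_finite : ∀ β n, Module.Finite ℂ ↥(wt n ⊓ gr β)

variable {𝒱 : StronglyGradedCVA A V} {W : Type*} [AddCommGroup W] [Module ℂ W]

/-- All generalized weights are real. -/
def StronglyGradedGenModule.RealGraded (M : StronglyGradedGenModule 𝒱 W) : Prop :=
  ∀ n : ℂ, n.im ≠ 0 → M.wt n = ⊥

/-- For every `β`, `W^(β)_[n] = 0` when the real part of `n` is sufficiently negative. -/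
def StronglyGradedGenModule.LowerBounded (M : StronglyGradedGenModule 𝒱 W) : Prop :=
  ∀ β : At, ∃ r : ℝ, ∀ n : ℂ, n.re < r → M.wt n ⊓ M.gr β = ⊥

/-! ### Subalgebras and the `C₁`-cofiniteness condition -/

/-- `V₀` is a conformal vertex subalgebra of `V` (with the same vacuum and conformal vector) that
is strongly graded with respect to `A₀`: `V₀ = ∐_{α ∈ A₀, n ∈ ℤ} V₀ ∩ V^(α) ∩ V_(n)`. The remaining
conditions in the definition of a strong grading are inherited from `V`. -/
structure IsStronglyGradedSubalgebra (𝒱 : StronglyGradedCVA A V) (A₀ : AddSubgroup At)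
    (V₀ : Submodule ℂ V) : Prop where
  vac_mem : 𝒱.vac ∈ V₀
  ω_mem : 𝒱.ω ∈ V₀
  Y_mem : ∀ (n : ℤ), ∀ u ∈ V₀, ∀ v ∈ V₀, 𝒱.Y n u v ∈ V₀
  graded : V₀ = ⨆ α : {α : A // (α : At) ∈ A₀}, ⨆ n : ℤ, V₀ ⊓ (𝒱.wt n ⊓ 𝒱.gr α)

/-- `(V₀)₊ = ∐_{n > 0} (V₀)_(n)`. -/
def positivePart (𝒱 : StronglyGradedCVA A V) (V₀ : Submodule ℂ V) : Submodule ℂ V :=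
  ⨆ n : {n : ℤ // 0 < n}, V₀ ⊓ 𝒱.wt n

/-- `C₁(W)` for `W` as a `V₀`-module: the span of all `u_{-1} w` with `u ∈ (V₀)₊`, `w ∈ W`. -/
def StronglyGradedGenModule.C₁ (M : StronglyGradedGenModule 𝒱 W) (V₀ : Submodule ℂ V) :
    Submodule ℂ W :=
  Submodule.span ℂ {x | ∃ u ∈ positivePart 𝒱 V₀, ∃ w : W, x = M.Y (-1) u w}

/-- `W` is `C₁`-cofinite as a `V₀`-module: `W^(β) / (C₁(W) ∩ W^(β))` is finite-dimensional for
every `β ∈ Ã`. -/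
def StronglyGradedGenModule.C₁Cofinite (M : StronglyGradedGenModule 𝒱 W)
    (V₀ : Submodule ℂ V) : Prop :=
  ∀ β : At, Module.Finite ℂ (↥(M.gr β) ⧸ (M.C₁ V₀).submoduleOf (M.gr β))

end Modules

/-! ## Facts needed to construct the contragredient module -/

section Facts

theorem mem_of_independent {ι E : Type*} [AddCommGroup E] [Module ℂ E]
    {f g : ι → Submodule ℂ E} (hfg : ∀ i, f i ≤ g i) (hg : iSupIndep g) (hf : ⨆ i, f i = ⊤)
    (i : ι) {x : E} (hx : x ∈ g i) : x ∈ f i := by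
  have hx' : x ∈ f i ⊔ ⨆ (j) (_ : j ≠ i), f j := by
    have : (⊤ : Submodule ℂ E) ≤ f i ⊔ ⨆ (j) (_ : j ≠ i), f j := by
      rw [← hf]
      refine iSup_le fun j => ?_
      by_cases h : j = i
      · subst h; exact le_sup_left
      · exact le_sup_of_le_right (le_iSup₂_of_le j h le_rfl)
    exact this trivial
  obtain ⟨a, ha, b, hb, rfl⟩ := Submodule.mem_sup.1 hx'
  have hb1 : b ∈ g i := by
    have := (g i).sub_mem hx (hfg i ha)
    simpa using this
  have hb2 : b ∈ ⨆ (j) (_ : j ≠ i), g j :=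
    (iSup₂_mono fun j _ => hfg j) hb
  have : b = 0 := by
    have := (Submodule.disjoint_def.1 (hg i)) b hb1 hb2
    exact this
  simpa [this] using ha

variable {At : Type*} [AddCommGroup At] {A : AddSubgroup At}
  {V : Type*} [AddCommGroup V] [Module ℂ V] {𝒱 : StronglyGradedCVA A V}
  {W : Type*} [AddCommGroup W] [Module ℂ W]

theorem mem_wt_of_L_zero {n : ℤ} {v : V} (hv : vir 𝒱.Y 𝒱.ω 0 v = (n : ℂ) • v) :
    v ∈ 𝒱.wt n := by
  refine mem_of_independent (f := 𝒱.wt)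
    (g := fun n : ℤ => Module.End.eigenspace (vir 𝒱.Y 𝒱.ω 0) (n : ℂ)) ?_ ?_ 𝒱.wt_span n ?_
  · intro i x hx
    exact Module.End.mem_eigenspace_iff.2 (𝒱.L_zero i x hx)
  · exact (Module.End.eigenspaces_iSupIndep (vir 𝒱.Y 𝒱.ω 0)).comp Int.cast_injective
  · exact Module.End.mem_eigenspace_iff.2 hv

/-- `L(1) V^(α)_(n) ⊆ V^(α)_(n-1)`. -/
theorem L_one_mem {n : ℤ} {α : A} {v : V} (hv : v ∈ 𝒱.wt n ⊓ 𝒱.gr α) :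
    vir 𝒱.Y 𝒱.ω 1 v ∈ 𝒱.wt (n - 1) ⊓ 𝒱.gr α := by
  refine ⟨mem_wt_of_L_zero ?_, ?_⟩
  · have h := 𝒱.virasoro 0 1 v
    rw [𝒱.L_zero n v hv.1] at h
    simp only [Int.cast_zero, Int.cast_one, zero_add, one_ne_zero, if_false, zero_smul, add_zero,
      map_smul, sub_eq_iff_eq_add] at h
    rw [h]
    push_cast
    module
  · have := 𝒱.gr_Y 0 α (1 + 1) 𝒱.ω 𝒱.ω_mem_gr v hv.2
    simpa [vir] using this

theorem L_one_pow_mem {n : ℤ} {α : A} {v : V} (hv : v ∈ 𝒱.wt n ⊓ 𝒱.gr α) (j : ℕ) :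
    (vir 𝒱.Y 𝒱.ω 1 ^ j) v ∈ 𝒱.wt (n - j) ⊓ 𝒱.gr α := by
  induction j with
  | zero => simpa using hv
  | succ j ih =>
    rw [pow_succ', Module.End.mul_apply]
    have := L_one_mem ih
    push_cast
    rwa [← sub_sub]

theorem doubly_span : ⨆ (α : A) (n : ℤ), 𝒱.wt n ⊓ 𝒱.gr α = ⊤ := by
  rw [← 𝒱.gr_span]
  exact iSup_congr fun α => (𝒱.gr_compatible α).symm

/-- `L(1)` is locally nilpotent on `V`. -/
theorem L_one_nilpotent (v : V) : ∃ N : ℕ, ∀ j ≥ N, (vir 𝒱.Y 𝒱.ω 1 ^ j) v = 0 := by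
  have hv : v ∈ ⨆ (α : A) (n : ℤ), 𝒱.wt n ⊓ 𝒱.gr α := by rw [doubly_span]; trivial
  rw [iSup_prod' (f := fun α n => 𝒱.wt n ⊓ 𝒱.gr α)] at hv
  induction hv using Submodule.iSup_induction' with
  | mem p x hx =>
    obtain ⟨α, n⟩ := p
    obtain ⟨N, hN⟩ := 𝒱.gr_lower α
    refine ⟨(n - N + 1).toNat, fun j hj => ?_⟩
    have h := L_one_pow_mem hx j
    rw [hN (n - j) (by omega)] at h
    simpa using h
  | zero => exact ⟨0, by simp⟩
  | add x y _ _ hx hy =>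
    obtain ⟨N, hN⟩ := hx
    obtain ⟨N', hN'⟩ := hy
    refine ⟨max N N', fun j hj => ?_⟩
    rw [map_add, hN j (le_trans (le_max_left _ _) hj), hN' j (le_trans (le_max_right _ _) hj),
      add_zero]

/-- `v_n W_[p] ⊆ W_[p+h-n-1]` for `v ∈ V_(h)`. -/
theorem mode_mem_wt (M : StronglyGradedGenModule 𝒱 W) {h n : ℤ} {p : ℂ} {v : V} {w : W}
    (hv : v ∈ 𝒱.wt h) (hw : w ∈ M.wt p) : M.Y n v w ∈ M.wt (p + h - n - 1) := by
  have comm : ∀ x : W, vir M.Y 𝒱.ω 0 (M.Y n v x)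
      = M.Y n v (vir M.Y 𝒱.ω 0 x) + ((h : ℂ) - n - 1) • M.Y n v x := by
    intro x
    have hj := M.jacobi 𝒱.ω v x 0 1 n
    have e1 : ∀ i : ℕ, i ≠ 0 → (Ring.choose (0 : ℤ) i) = 0 := fun i hi => by
      have := Ring.choose_natCast (R := ℤ) 0 i
      simp only [Nat.cast_zero] at this
      rw [this, Nat.choose_eq_zero_of_lt (Nat.pos_of_ne_zero hi), Nat.cast_zero]
    have e2 : ∀ i : ℕ, 1 < i → (Ring.choose (1 : ℤ) i) = 0 := fun i hi => by
      have := Ring.choose_natCast (R := ℤ) 1 i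
      simp only [Nat.cast_one] at this
      rw [this, Nat.choose_eq_zero_of_lt hi, Nat.cast_zero]
    rw [finsum_eq_single _ 0 (fun i hi => by simp [e1 i hi]),
      finsum_eq_single _ 0 (fun i hi => by simp [e1 i hi]),
      finsum_eq_sum_of_support_subset (s := Finset.range 2) _ (by
        intro i hi
        simp only [Finset.coe_range, Set.mem_Iio]
        by_contra hc
        exact hi (by simp [e2 i (by omega)]))] at hj
    have h1 := M.derivative v (n + 1) x
    have h2 := 𝒱.L_zero h v hv
    simp only [vir] at h1 h2 ⊢
    norm_num at h1 h2 ⊢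
    simp [Finset.sum_range_succ, h2] at hj
    rw [h1] at hj
    rw [sub_eq_iff_eq_add] at hj
    rw [hj]
    module
  have shift : ∀ (k : ℕ) (x : W),
      ((vir M.Y 𝒱.ω 0 - (p + h - n - 1) • (LinearMap.id : W →ₗ[ℂ] W)) ^ k) (M.Y n v x)
        = M.Y n v (((vir M.Y 𝒱.ω 0 - p • (LinearMap.id : W →ₗ[ℂ] W)) ^ k) x) := by
    intro k
    induction k with
    | zero => intro x; simp
    | succ k ih =>
      intro x
      rw [pow_succ, pow_succ, Module.End.mul_apply, Module.End.mul_apply, ← ih]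
      congr 1
      simp only [LinearMap.sub_apply, LinearMap.smul_apply, LinearMap.id_apply, comm, map_sub,
        map_smul]
      module
  refine mem_of_independent (f := M.wt)
    (g := fun q : ℂ => Module.End.maxGenEigenspace (vir M.Y 𝒱.ω 0) q) ?_ ?_ M.wt_span _ ?_
  · intro q x hx
    obtain ⟨k, hk⟩ := M.L_zero q x hx
    exact Module.End.mem_maxGenEigenspace _ _ _ |>.2 ⟨k, hk⟩
  · exact Module.End.independent_maxGenEigenspace _
  · obtain ⟨k, hk⟩ := M.L_zero p w hw
    refine Module.End.mem_maxGenEigenspace _ _ _ |>.2 ⟨k, ?_⟩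
    have := shift k w
    rw [hk, map_zero] at this
    exact this

end Facts

/-! ## The contragredient module -/

section Contragredient

variable {At : Type*} [AddCommGroup At] {A : AddSubgroup At}
  {V : Type*} [AddCommGroup V] [Module ℂ V] {𝒱 : StronglyGradedCVA A V}
  {W : Type*} [AddCommGroup W] [Module ℂ W]

/-- For `v ∈ V_(h)`, the coefficient of `x^{-n-1}` in `Y(e^{xL(1)}(-x^{-2})^{L(0)}v, x^{-1})`,
namely `(-1)^h ∑_j (1/j!) (L(1)^j v)_{2h-n-2-j}` (a finite sum, by local nilpotency of `L(1)`). -/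
def oppositeModeFun (M : StronglyGradedGenModule 𝒱 W) (h n : ℤ) (v : V) : W →ₗ[ℂ] W :=
  ∑ᶠ j : ℕ, (((-1 : ℂ) ^ h) * ((j.factorial : ℂ))⁻¹) •
    M.Y (2 * h - n - 2 - j) ((vir 𝒱.Y 𝒱.ω 1 ^ j) v)

theorem oppositeModeFun_support (M : StronglyGradedGenModule 𝒱 W) (h n : ℤ) (v : V) :
    (Function.support fun j : ℕ => (((-1 : ℂ) ^ h) * ((j.factorial : ℂ))⁻¹) •
      M.Y (2 * h - n - 2 - j) ((vir 𝒱.Y 𝒱.ω 1 ^ j) v)).Finite := by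
  obtain ⟨N, hN⟩ := L_one_nilpotent (𝒱 := 𝒱) v
  refine (Set.finite_lt_nat N).subset fun j hj => ?_
  by_contra hc
  exact hj (by simp [hN j (not_lt.1 hc)])

/-- `oppositeModeFun` as a linear map in `v`. -/
def oppositeModeLin (M : StronglyGradedGenModule 𝒱 W) (h n : ℤ) : V →ₗ[ℂ] W →ₗ[ℂ] W where
  toFun := oppositeModeFun M h n
  map_add' u v := by
    unfold oppositeModeFun
    rw [← finsum_add_distrib (oppositeModeFun_support M h n u) (oppositeModeFun_support M h n v)]
    exact finsum_congr fun j => by simp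
  map_smul' a v := by
    unfold oppositeModeFun
    rw [RingHom.id_apply, smul_finsum' a (oppositeModeFun_support M h n v)]
    exact finsum_congr fun j => by simp [smul_comm a]

theorem wt_isInternal (𝒱 : StronglyGradedCVA A V) : DirectSum.IsInternal 𝒱.wt :=
  DirectSum.isInternal_submodule_of_iSupIndep_of_iSup_eq_top 𝒱.wt_indep 𝒱.wt_span

/-- The decomposition of `V` into its weight spaces. -/
def wtEquiv (𝒱 : StronglyGradedCVA A V) : (DirectSum ℤ fun n => ↥(𝒱.wt n)) ≃ₗ[ℂ] V :=
  LinearEquiv.ofBijective (DirectSum.coeLinearMap 𝒱.wt) (wt_isInternal 𝒱)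

/-- The coefficient `v_n^o` of `x^{-n-1}` in the opposite vertex operator
`Y^o(v, x) = Y(e^{xL(1)}(-x^{-2})^{L(0)}v, x^{-1})`, for all `v ∈ V`. -/
def oppositeMode (M : StronglyGradedGenModule 𝒱 W) : Modes V W := fun n =>
  (DirectSum.toModule ℂ ℤ (W →ₗ[ℂ] W)
    (fun h => (oppositeModeLin M h n).comp (𝒱.wt h).subtype)).comp
    (wtEquiv 𝒱).symm.toLinearMap

theorem oppositeMode_of_mem (M : StronglyGradedGenModule 𝒱 W) {h n : ℤ} {v : V}
    (hv : v ∈ 𝒱.wt h) : oppositeMode M n v = oppositeModeFun M h n v := by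
  have : (wtEquiv 𝒱).symm v = DirectSum.lof ℂ ℤ (fun n => ↥(𝒱.wt n)) h ⟨v, hv⟩ := by
    rw [LinearEquiv.symm_apply_eq]
    exact (DirectSum.coeLinearMap_lof 𝒱.wt h ⟨v, hv⟩).symm
  simp only [oppositeMode, LinearMap.comp_apply, LinearEquiv.coe_coe, this, DirectSum.toModule_lof]
  rfl

theorem oppositeMode_mem (M : StronglyGradedGenModule 𝒱 W) {h n : ℤ} {α : A} {β : At} {p : ℂ}
    {v : V} {w : W} (hv : v ∈ 𝒱.wt h ⊓ 𝒱.gr α) (hw : w ∈ M.wt p ⊓ M.gr β) :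
    oppositeMode M n v w ∈ M.wt (p + n + 1 - h) ⊓ M.gr ((α : At) + β) := by
  rw [oppositeMode_of_mem M hv.1, oppositeModeFun,
    finsum_eq_sum _ (oppositeModeFun_support M h n v), LinearMap.sum_apply]
  refine Submodule.sum_mem _ fun j _ => ?_
  rw [LinearMap.smul_apply]
  refine Submodule.smul_mem _ _ ⟨?_, ?_⟩
  · have := mode_mem_wt M (n := 2 * h - n - 2 - j) (L_one_pow_mem hv j).1 hw.1
    have e : p + ((h - j : ℤ) : ℂ) - ((2 * h - n - 2 - j : ℤ) : ℂ) - 1 = p + n + 1 - h := by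
      push_cast
      ring
    rwa [e] at this
  · exact M.gr_Y α β _ _ (L_one_pow_mem hv j).2 w hw.2

/-- `(W^(β)_[n])*`, identified with the linear functionals on `W` that vanish on every
`W^(γ)_[m]` with `(γ, m) ≠ (β, n)`. -/
def dualPiece (M : StronglyGradedGenModule 𝒱 W) (β : At) (n : ℂ) :
    Submodule ℂ (Module.Dual ℂ W) where
  carrier := {f | ∀ (γ : At) (m : ℂ), (γ, m) ≠ (β, n) → ∀ w ∈ M.wt m ⊓ M.gr γ, f w = 0}
  add_mem' hf hg γ m h w hw := by simp [hf γ m h w hw, hg γ m h w hw]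
  zero_mem' γ m h w hw := rfl
  smul_mem' a f hf γ m h w hw := by simp [hf γ m h w hw]

/-- `(W')^(β) = ∐_n (W^(-β)_[n])*`. -/
def dualGr (M : StronglyGradedGenModule 𝒱 W) (β : At) : Submodule ℂ (Module.Dual ℂ W) :=
  ⨆ n : ℂ, dualPiece M (-β) n

/-- `W' = ∐_{β, n} (W')^(β)_[n] ⊆ W*`. -/
def restrictedDual (M : StronglyGradedGenModule 𝒱 W) : Submodule ℂ (Module.Dual ℂ W) :=
  ⨆ β : At, dualGr M β

theorem dualPiece_comp (M : StronglyGradedGenModule 𝒱 W) {h n : ℤ} {α : A} {β : At} {p : ℂ}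
    {v : V} {f : Module.Dual ℂ W} (hv : v ∈ 𝒱.wt h ⊓ 𝒱.gr α) (hf : f ∈ dualPiece M β p) :
    f.comp (oppositeMode M n v) ∈ dualPiece M (β - α) (p - n - 1 + h) := by
  intro γ m hne w hw
  refine hf _ _ ?_ _ (oppositeMode_mem M (n := n) hv hw)
  intro he
  rw [Prod.mk.injEq] at he
  refine hne ?_
  rw [← he.1, ← he.2]
  ext
  · simp
  · simp only []
    ring

theorem dualGr_comp (M : StronglyGradedGenModule 𝒱 W) {n : ℤ} {α : A} {β : At}
    {v : V} {f : Module.Dual ℂ W} (hv : v ∈ 𝒱.gr α) (hf : f ∈ dualGr M β) :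
    f.comp (oppositeMode M n v) ∈ dualGr M ((α : At) + β) := by
  rw [𝒱.gr_compatible α] at hv
  induction hv using Submodule.iSup_induction' with
  | mem h v hv =>
    induction hf using Submodule.iSup_induction' with
    | mem p f hf =>
      have := dualPiece_comp M (n := n) hv hf
      refine Submodule.mem_iSup_of_mem (p - n - 1 + h) ?_
      rwa [neg_add_rev, ← sub_eq_add_neg]
    | zero => simp
    | add f g _ _ hf hg => rw [LinearMap.add_comp]; exact Submodule.add_mem _ hf hg
  | zero => simp
  | add u v _ _ hu hv => rw [map_add, LinearMap.comp_add]; exact Submodule.add_mem _ hu hv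

theorem restrictedDual_comp (M : StronglyGradedGenModule 𝒱 W) (n : ℤ) (v : V)
    {f : Module.Dual ℂ W} (hf : f ∈ restrictedDual M) :
    f.comp (oppositeMode M n v) ∈ restrictedDual M := by
  have hv : v ∈ ⨆ α, 𝒱.gr α := by rw [𝒱.gr_span]; trivial
  induction hv using Submodule.iSup_induction' with
  | mem α v hv =>
    induction hf using Submodule.iSup_induction' with
    | mem β f hf => exact Submodule.mem_iSup_of_mem _ (dualGr_comp M hv hf)
    | zero => simp
    | add f g _ _ hf hg => rw [LinearMap.add_comp]; exact Submodule.add_mem _ hf hg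
  | zero => simp
  | add u v _ _ hu hv => rw [map_add, LinearMap.comp_add]; exact Submodule.add_mem _ hu hv

/-- The contragredient `(W', Y')`: the adjoint vertex operators are given by
`⟨Y'(v, x)w', w⟩ = ⟨w', Y(e^{xL(1)}(-x^{-2})^{L(0)}v, x^{-1})w⟩`. -/
def contragredient (M : StronglyGradedGenModule 𝒱 W) : GradedAction 𝒱 ↥(restrictedDual M) where
  Y n := LinearMap.mk₂ ℂ
    (fun v f => ⟨(f : Module.Dual ℂ W).comp (oppositeMode M n v), restrictedDual_comp M n v f.2⟩)
    (fun u v f => by ext w; simp)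
    (fun a v f => by ext w; simp)
    (fun v f g => by ext w; simp)
    (fun a v f => by ext w; simp)
  gr β := (dualGr M β).submoduleOf (restrictedDual M)
  gr_Y α β n v hv f hf := by
    simp only [Submodule.submoduleOf, Submodule.mem_comap] at hf ⊢
    exact dualGr_comp M hv hf

end Contragredient

/-! ## Logarithmic intertwining operators and fusion rules -/

/-- The components of a map `w₁ ⊗ w₂ ↦ 𝒴(w₁, x)w₂ = ∑_{n ∈ ℂ, k ∈ ℕ} (𝒴 n k w₁ w₂) x^{-n-1} (log x)^k`. -/
abbrev LogModes (W₁ W₂ W₃ : Type*) [AddCommGroup W₁] [Module ℂ W₁] [AddCommGroup W₂]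
    [Module ℂ W₂] [AddCommGroup W₃] [Module ℂ W₃] :=
  ℂ → ℕ → W₁ →ₗ[ℂ] W₂ →ₗ[ℂ] W₃

/-- `𝒴` is a logarithmic intertwining operator of type `W₃` over `W₁ W₂`, where `U` (with conformal
vector `ω`) acts on `Wᵢ` by the modes `Yᵢ`. -/
structure IsLogIntertwining {U W₁ W₂ W₃ : Type*} [AddCommGroup U] [Module ℂ U]
    [AddCommGroup W₁] [Module ℂ W₁] [AddCommGroup W₂] [Module ℂ W₂] [AddCommGroup W₃] [Module ℂ W₃]
    (ω : U) (Y₁ : Modes U W₁) (Y₂ : Modes U W₂) (Y₃ : Modes U W₃) (𝒴 : LogModes W₁ W₂ W₃) :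
    Prop where
  /-- Each power of `x` comes with a polynomial in `log x`. -/
  log_polynomial : ∀ w₁ w₂ n, {k : ℕ | 𝒴 n k w₁ w₂ ≠ 0}.Finite
  lower_truncation : ∀ w₁ w₂ n, ∃ N : ℕ, ∀ m ≥ N, ∀ k, 𝒴 (n + (m : ℂ)) k w₁ w₂ = 0
  jacobi : ∀ k, JacobiIdentity Y₁ Y₂ Y₃ (fun n => 𝒴 n k)
  /-- `𝒴(L(-1)w₁, x) = d/dx 𝒴(w₁, x)`. -/
  derivative : ∀ w₁ w₂ n k, 𝒴 n k (vir Y₁ ω (-1) w₁) w₂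
    = (-n) • 𝒴 (n - 1) k w₁ w₂ + ((k : ℂ) + 1) • 𝒴 (n - 1) (k + 1) w₁ w₂

section Fusion

variable {At : Type*} [AddCommGroup At] {A : AddSubgroup At}
  {V : Type*} [AddCommGroup V] [Module ℂ V] {𝒱 : StronglyGradedCVA A V}
  {W W₁ W₂ W₃ : Type*} [AddCommGroup W] [Module ℂ W]
  [AddCommGroup W₁] [Module ℂ W₁] [AddCommGroup W₂] [Module ℂ W₂] [AddCommGroup W₃] [Module ℂ W₃]

/-- A grading-compatible logarithmic intertwining operator of type `M₃` over `M₁ M₂`. -/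
structure IsGradedLogIntertwining (M₁ : GradedAction 𝒱 W₁) (M₂ : GradedAction 𝒱 W₂)
    (M₃ : GradedAction 𝒱 W₃) (𝒴 : LogModes W₁ W₂ W₃) : Prop extends
    IsLogIntertwining 𝒱.ω M₁.Y M₂.Y M₃.Y 𝒴 where
  grading_compatible : ∀ (β γ : At), ∀ w₁ ∈ M₁.gr β, ∀ w₂ ∈ M₂.gr γ, ∀ n k,
    𝒴 n k w₁ w₂ ∈ M₃.gr (β + γ)

/-- The action of `V^(0)` on the homogeneous subspace `W^(β)`. -/
def GradedAction.component (M : GradedAction 𝒱 W) (β : At) :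
    Modes ↥(𝒱.gr 0) ↥(M.gr β) := fun n =>
  LinearMap.mk₂ ℂ
    (fun v w => ⟨M.Y n v w, by simpa using M.gr_Y 0 β n v v.2 w w.2⟩)
    (fun u v w => by ext; simp)
    (fun a v w => by ext; simp)
    (fun v w w' => by ext; simp)
    (fun a v w => by ext; simp)

/-- The fusion rule for the `V^(0)`-modules `M₁^(β₁)`, `M₂^(β₂)` and `M₃^(β₁+β₂)`: the dimension of
the space of logarithmic intertwining operators among them. (These operators form a subspace, so
the span adds nothing.) -/
def fusionRule (M₁ : GradedAction 𝒱 W₁) (M₂ : GradedAction 𝒱 W₂) (M₃ : GradedAction 𝒱 W₃)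
    (β₁ β₂ : At) : Cardinal :=
  Module.rank ℂ (Submodule.span ℂ
    {𝒴 : LogModes ↥(M₁.gr β₁) ↥(M₂.gr β₂) ↥(M₃.gr (β₁ + β₂)) |
      IsLogIntertwining (⟨𝒱.ω, 𝒱.ω_mem_gr⟩ : ↥(𝒱.gr 0))
        (M₁.component β₁) (M₂.component β₂) (M₃.component (β₁ + β₂)) 𝒴})

/-- For all `β₁, β₂ ∈ Ã`, the fusion rule for `M₁^(γ₁)`, `M₂^(γ₂)`, `M₃^(γ₁+γ₂)` is nonzero for only
finitely many pairs `(γ₁, γ₂) ∈ (β₁ + A₀) × (β₂ + A₀)`. -/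
def FiniteFusion (A₀ : AddSubgroup At) (M₁ : GradedAction 𝒱 W₁) (M₂ : GradedAction 𝒱 W₂)
    (M₃ : GradedAction 𝒱 W₃) : Prop :=
  ∀ β₁ β₂ : At, {γ : At × At | γ.1 - β₁ ∈ A₀ ∧ γ.2 - β₂ ∈ A₀ ∧
    fusionRule M₁ M₂ M₃ γ.1 γ.2 ≠ 0}.Finite

end Fusion

/-! ## Differential equations for formal series in `z₁, z₂, log z₁, log z₂` -/

/-- The ring `ℂ[z₁^{±1}, z₂^{±1}, (z₁ - z₂)⁻¹]`. -/
abbrev CoeffRing : Type :=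
  Localization.Away
    (MvPolynomial.X 0 * MvPolynomial.X 1 * (MvPolynomial.X 0 - MvPolynomial.X 1) :
      MvPolynomial (Fin 2) ℂ)

/-- `z₁` in `ℂ((z₁))((z₂))`. -/
def lz₁ : LaurentSeries (LaurentSeries ℂ) := HahnSeries.C (HahnSeries.single 1 1)

/-- `z₂` in `ℂ((z₁))((z₂))`. -/
def lz₂ : LaurentSeries (LaurentSeries ℂ) := HahnSeries.single 1 1

/-- The substitution `ℂ[z₁, z₂] → ℂ((z₁))((z₂))`. -/
def polyExpand : MvPolynomial (Fin 2) ℂ →+* LaurentSeries (LaurentSeries ℂ) :=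
  MvPolynomial.eval₂Hom
    ((HahnSeries.C : LaurentSeries ℂ →+* LaurentSeries (LaurentSeries ℂ)).comp
      (HahnSeries.C : ℂ →+* LaurentSeries ℂ)) ![lz₁, lz₂]

theorem isUnit_laurent (x : LaurentSeries (LaurentSeries ℂ)) (h : x ≠ 0) : IsUnit x :=
  IsUnit.mk0 x h

theorem polyExpand_isUnit :
    IsUnit (polyExpand
      (MvPolynomial.X 0 * MvPolynomial.X 1 * (MvPolynomial.X 0 - MvPolynomial.X 1))) := by
  have hs : (HahnSeries.single (1 : ℤ) (1 : ℂ)) ≠ 0 := HahnSeries.single_ne_zero one_ne_zero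
  have h1 : IsUnit lz₁ := by
    refine isUnit_laurent _ fun h => ?_
    have := congrArg (fun s : LaurentSeries (LaurentSeries ℂ) => s.coeff 0) h
    simp only [lz₁, HahnSeries.C_apply, HahnSeries.coeff_single_same, HahnSeries.coeff_zero] at this
    exact hs this
  have h2 : IsUnit lz₂ := by
    refine isUnit_laurent _ fun h => ?_
    have := congrArg (fun s : LaurentSeries (LaurentSeries ℂ) => s.coeff 1) h
    simp [lz₂] at this
  have h3 : IsUnit (lz₁ - lz₂) := by
    refine isUnit_laurent _ fun h => ?_
    have := congrArg (fun s : LaurentSeries (LaurentSeries ℂ) => s.coeff 1) h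
    simp [lz₁, lz₂, HahnSeries.C_apply, HahnSeries.coeff_single_of_ne] at this
  have e0 : polyExpand (MvPolynomial.X 0) = lz₁ := by simp [polyExpand]
  have e1 : polyExpand (MvPolynomial.X 1) = lz₂ := by simp [polyExpand]
  rw [map_mul, map_mul, map_sub, e0, e1]
  exact (h1.mul h2).mul h3

/-- The expansion of elements of `ℂ[z₁^{±1}, z₂^{±1}, (z₁ - z₂)⁻¹]` in the region
`|z₁| > |z₂| > 0`: the ring homomorphism to `ℂ((z₁))((z₂))` with `z₁ ↦ z₁`, `z₂ ↦ z₂`; it sends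
`(z₁ - z₂)⁻¹` to `∑_{k ≥ 0} z₁^{-1-k} z₂^k`. -/
def expand : CoeffRing →+* LaurentSeries (LaurentSeries ℂ) :=
  IsLocalization.Away.lift _ polyExpand_isUnit

/-- The coefficient of `z₁^i z₂^j` in the expansion of `a` in `|z₁| > |z₂| > 0`. -/
def expandCoeff (a : CoeffRing) (i j : ℤ) : ℂ := ((expand a).coeff j).coeff i

/-- Formal series `∑ φ p q k l z₁^p z₂^q (log z₁)^k (log z₂)^l` with `p, q ∈ ℂ`, `k, l ∈ ℕ`. -/
abbrev LogSeries : Type := ℂ → ℂ → ℕ → ℕ → ℂ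

/-- `∂/∂z₁`. -/
def partial₁ (φ : LogSeries) : LogSeries := fun p q k l =>
  (p + 1) * φ (p + 1) q k l + ((k : ℂ) + 1) * φ (p + 1) q (k + 1) l

/-- `∂/∂z₂`. -/
def partial₂ (φ : LogSeries) : LogSeries := fun p q k l =>
  (q + 1) * φ p (q + 1) k l + ((l : ℂ) + 1) * φ p (q + 1) k (l + 1)

/-- The product of the expansion of `a` in `|z₁| > |z₂| > 0` with the series `φ` exists: every
coefficient of the product is a finite sum. -/
def ProductExists (a : CoeffRing) (φ : LogSeries) : Prop :=
  ∀ (p q : ℂ) (k l : ℕ),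
    (Function.support fun ij : ℤ × ℤ => expandCoeff a ij.1 ij.2 * φ (p - ij.1) (q - ij.2) k l).Finite

/-- The product of the expansion of `a` in `|z₁| > |z₂| > 0` with the series `φ`. -/
def expandMul (a : CoeffRing) (φ : LogSeries) : LogSeries := fun p q k l =>
  ∑ᶠ ij : ℤ × ℤ, expandCoeff a ij.1 ij.2 * φ (p - ij.1) (q - ij.2) k l

/-- `φ` satisfies the expansion in `|z₁| > |z₂| > 0` of
`D^m φ + a₁ D^{m-1} φ + ⋯ + a_m φ = 0`, where `D` is `∂/∂z₁` or `∂/∂z₂`. -/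
def SatisfiesODE (D : LogSeries → LogSeries) (m : ℕ) (a : ℕ → CoeffRing) (φ : LogSeries) : Prop :=
  (∀ k ∈ Finset.Icc 1 m, ProductExists (a k) (D^[m - k] φ)) ∧
    D^[m] φ + ∑ k ∈ Finset.Icc 1 m, expandMul (a k) (D^[m - k] φ) = 0

section MatrixElement

variable {At : Type*} [AddCommGroup At] {A : AddSubgroup At}
  {V : Type*} [AddCommGroup V] [Module ℂ V] {𝒱 : StronglyGradedCVA A V}
  {W₀ W₁ W₂ W₃ W₄ : Type*} [AddCommGroup W₀] [Module ℂ W₀]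
  [AddCommGroup W₁] [Module ℂ W₁] [AddCommGroup W₂] [Module ℂ W₂] [AddCommGroup W₃] [Module ℂ W₃]
  [AddCommGroup W₄] [Module ℂ W₄]

/-- The series `⟨w₀, 𝒴₁(w₁, z₁) 𝒴₂(w₂, z₂) w₃⟩`. -/
def matrixElement (M₀ : StronglyGradedGenModule 𝒱 W₀)
    (𝒴₁ : LogModes W₁ W₄ ↥(restrictedDual M₀)) (𝒴₂ : LogModes W₂ W₃ W₄)
    (w₀ : W₀) (w₁ : W₁) (w₂ : W₂) (w₃ : W₃) : LogSeries := fun p q k l =>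
  (𝒴₁ (-p - 1) k w₁ (𝒴₂ (-q - 1) l w₂ w₃) : Module.Dual ℂ W₀) w₀

end MatrixElement

end

end VertexAlg

open VertexAlg

/-!
Let `R = ℂ[z₁^{±1}, z₂^{±1}, (z₁ - z₂)⁻¹]`, acting on formal series through its expansion in
`|z₁| > |z₂| > 0`. The matrix elements `Φ(w₀, w₁, w₂, w₃) = ⟨w₀, 𝒴₁(w₁, z₁) 𝒴₂(w₂, z₂) w₃⟩`, with
`wᵢ` in fixed homogeneous subspaces `Wᵢ^(βᵢ)`, all lie in one finitely generated `R`-module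
(`exists_fg_matrixMap_mem`). Since `∂Φ/∂z₁` and `∂Φ/∂z₂` are again such matrix elements, with
`L(-1)w₁` and `L(-1)w₂` as arguments, and `R` is noetherian, the iterated derivatives of `Φ` satisfy
a monic linear relation over `R`, in either variable; this is the differential equation
(`exists_satisfiesODE`).

The finite generation rests on four relations, one for each argument, which express
`Φ(…, u_{-1}wᵢ, …)` with `u` homogeneous of positive weight through matrix elements whose arguments
have strictly smaller total weight. They follow from the commutator and iterate formulas contained
in the Jacobi identity (`matrixMap_mode₁`, `matrixMap_mode₂`, `matrixMap_mode₃`); for `w₀` one uses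
in addition that the opposite of the opposite vertex operator is the original one
(`mode_eq_sum_oppositeMode`). The infinite sums which appear are expansions of powers of
`(z₁ - z₂)⁻¹`, so the coefficients lie in `R`. By `C₁`-cofiniteness all but finitely many
generalized weight spaces of each `Wᵢ^(β)` consist of sums of such elements `u_{-1}w`
(`StronglyGradedGenModule.C₁Cofinite.exists_finset`). The relations shift the degrees by elements of
`A₀`, but a matrix element vanishes unless its degrees add up to zero and both fusion rules involved
are nonzero (`degrees_of_matrixMap_ne_zero`), so only finitely many degrees occur. On these the
weights are uniformly bounded below, and induction on the total weight reduces every matrix element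
to those with arguments in finitely many finite-dimensional spaces.

Series in complex powers of `z₁, z₂` are handled through the field `ℂ((z₁))((z₂))`: for every choice
of base exponents `p, q` and of powers of the logarithms, the coefficients at `z₁^{p+i} z₂^{q+j}`
with integers `i, j` form an element of that field, and `R` acts by multiplication in it
(`SeriesSpace`).
-/

namespace VertexAlg

noncomputable section

/-! ### Iterated Laurent series and their coefficients -/

/-- The field `ℂ((z₁))((z₂))`, as a type of its own: its zero, its subtraction and the other
operations are those of a single field structure. -/
def IterLaurent : Type := LaurentSeries (LaurentSeries ℂ)

instance : Field IterLaurent := inferInstanceAs (Field (LaurentSeries (LaurentSeries ℂ)))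

/-- The coefficient of `z₁^i z₂^j`. -/
def lcoeff (x : IterLaurent) (i j : ℤ) : ℂ := (HahnSeries.coeff x j).coeff i

theorem lcoeff_ext {x y : IterLaurent} (h : ∀ i j, lcoeff x i j = lcoeff y i j) : x = y := by
  apply HahnSeries.ext
  funext j
  ext i
  exact h i j

@[simp] theorem lcoeff_zero (i j : ℤ) : lcoeff 0 i j = 0 := rfl

@[simp] theorem lcoeff_add (x y : IterLaurent) (i j : ℤ) :
    lcoeff (x + y) i j = lcoeff x i j + lcoeff y i j := rfl

@[simp] theorem lcoeff_sub (x y : IterLaurent) (i j : ℤ) :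
    lcoeff (x - y) i j = lcoeff x i j - lcoeff y i j := rfl

theorem lcoeff_sum {ι : Type*} (s : Finset ι) (f : ι → IterLaurent) (i j : ℤ) :
    lcoeff (∑ m ∈ s, f m) i j = ∑ m ∈ s, lcoeff (f m) i j := by
  classical
  induction s using Finset.induction_on with
  | empty => simp
  | insert a s ha ih => rw [Finset.sum_insert ha, Finset.sum_insert ha, lcoeff_add, ih]

/-- The series with the given coefficients, which have to be bounded below in `z₂`, and in `z₁`
for every power of `z₂`. -/
def lseries (f : ℤ → ℤ → ℂ) (h₂ : ∃ N, ∀ j < N, ∀ i, f i j = 0)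
    (h₁ : ∀ j, ∃ N, ∀ i < N, f i j = 0) : IterLaurent :=
  HahnSeries.ofSuppBddBelow (R := LaurentSeries ℂ)
    (fun j => HahnSeries.ofSuppBddBelow (fun i => f i j)
      ((h₁ j).imp fun N hN i hi => by
        by_contra hc
        exact hi (hN i (not_le.1 hc))))
    (h₂.imp fun N hN j hj => by
        by_contra hc
        refine hj ?_
        ext i
        exact hN j (not_le.1 hc) i)

@[simp] theorem lcoeff_lseries (f : ℤ → ℤ → ℂ) (h₂ : ∃ N, ∀ j < N, ∀ i, f i j = 0)
    (h₁ : ∀ j, ∃ N, ∀ i < N, f i j = 0) (i j : ℤ) : lcoeff (lseries f h₂ h₁) i j = f i j := rfl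

theorem laurent_coeff_eq_zero {R : Type*} [Zero R] (x : LaurentSeries R) :
    ∃ N : ℤ, ∀ n < N, x.coeff n = 0 :=
  ⟨x.order, fun _ hn => HahnSeries.coeff_eq_zero_of_lt_order hn⟩

theorem laurent_mul_support {R : Type*} [CommRing R] (x y : LaurentSeries R) (n : ℤ) :
    (Function.support fun m : ℤ => x.coeff m * y.coeff (n - m)).Finite := by
  obtain ⟨M, hM⟩ := laurent_coeff_eq_zero x
  obtain ⟨N, hN⟩ := laurent_coeff_eq_zero y
  refine (Set.finite_Icc M (n - N)).subset fun m hm => ?_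
  by_contra hc
  rw [Set.mem_Icc, not_and_or] at hc
  rcases hc with hc | hc
  · exact hm (by simp [hM m (by omega)])
  · exact hm (by simp [hN (n - m) (by omega)])

theorem laurent_coeff_mul {R : Type*} [CommRing R] (x y : LaurentSeries R) (n : ℤ) :
    (x * y).coeff n = ∑ᶠ m : ℤ, x.coeff m * y.coeff (n - m) := by
  rw [HahnSeries.coeff_mul,
    finsum_eq_sum_of_support_subset (s := (Finset.antidiagonal x.isPWO_support y.isPWO_support
      n).image Prod.fst)]
  · rw [Finset.sum_image]
    · refine Finset.sum_congr rfl fun p hp => ?_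
      rw [Finset.mem_antidiagonal] at hp
      rw [← hp.2.2, add_sub_cancel_left]
    · intro p hp q hq h
      simp only [Finset.mem_coe, Finset.mem_antidiagonal] at hp hq
      have h' : p.1 = q.1 := h
      have := hp.2.2.trans hq.2.2.symm
      exact Prod.ext h' (by omega)
  · intro m hm
    simp only [Finset.coe_image, Set.mem_image, Finset.mem_coe, Finset.mem_antidiagonal,
      Prod.exists]
    refine ⟨m, n - m, ⟨?_, ?_, by ring⟩, rfl⟩
    · exact left_ne_zero_of_mul hm
    · exact right_ne_zero_of_mul hm

theorem lcoeff_mul_support (x y : IterLaurent) (i j : ℤ) :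
    (Function.support fun m : ℤ × ℤ =>
      lcoeff x m.1 m.2 * lcoeff y (i - m.1) (j - m.2)).Finite := by
  have h1 := laurent_mul_support (R := LaurentSeries ℂ) x y j
  refine ((h1.biUnion fun b _ => (laurent_mul_support (HahnSeries.coeff x b)
    (HahnSeries.coeff y (j - b)) i).image fun a => (a, b)).subset ?_)
  rintro ⟨a, b⟩ hab
  simp only [Set.mem_iUnion, Set.mem_image, Prod.mk.injEq]
  refine ⟨b, ?_, a, hab, rfl, rfl⟩
  rw [Function.mem_support] at hab ⊢
  intro h0
  rcases mul_eq_zero.1 h0 with h0 | h0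
  · exact hab (by simp [lcoeff, h0])
  · exact hab (by simp [lcoeff, h0])

theorem lcoeff_mul (x y : IterLaurent) (i j : ℤ) :
    lcoeff (x * y) i j
      = ∑ᶠ m : ℤ × ℤ, lcoeff x m.1 m.2 * lcoeff y (i - m.1) (j - m.2) := by
  have h1 := laurent_mul_support (R := LaurentSeries ℂ) x y j
  have h2 : HahnSeries.coeff (x * y) j
      = ∑ᶠ m : ℤ, HahnSeries.coeff x m * HahnSeries.coeff y (j - m) :=
    laurent_coeff_mul (R := LaurentSeries ℂ) x y j
  rw [← finsum_comp_equiv (Equiv.prodComm ℤ ℤ), finsum_curry]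
  · simp only [Equiv.prodComm_apply, Prod.swap_prod_mk, lcoeff]
    rw [h2, finsum_eq_sum _ h1, HahnSeries.coeff_sum,
      finsum_eq_sum_of_support_subset (s := h1.toFinset)]
    · refine Finset.sum_congr rfl fun b _ => ?_
      rw [laurent_coeff_mul]
    · intro b hb
      simp only [Set.Finite.coe_toFinset, Function.mem_support]
      intro h0
      refine hb (finsum_eq_zero_of_forall_eq_zero fun a => ?_)
      rcases mul_eq_zero.1 h0 with h0 | h0 <;> simp [h0]
  · exact (lcoeff_mul_support x y i j).preimage (Equiv.prodComm ℤ ℤ).injective.injOn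

/-- The series `a z₁^m z₂^n`. -/
def lmonomial (a : ℂ) (m n : ℤ) : IterLaurent :=
  lseries (fun i j => if i = m ∧ j = n then a else 0)
    ⟨n, fun j hj i => if_neg (by omega)⟩ fun j => ⟨m, fun i hi => if_neg (by omega)⟩

theorem lcoeff_lmonomial_mul (a : ℂ) (m n : ℤ) (x : IterLaurent) (i j : ℤ) :
    lcoeff (lmonomial a m n * x) i j = a * lcoeff x (i - m) (j - n) := by
  rw [lcoeff_mul, finsum_eq_single _ (m, n)]
  · simp [lmonomial]
  · rintro ⟨b, c⟩ h
    have : ¬ (b = m ∧ c = n) := fun h' => h (Prod.ext h'.1 h'.2)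
    simp [lmonomial, this]

theorem lmonomial_mul (a b : ℂ) (m n p q : ℤ) :
    lmonomial a m n * lmonomial b p q = lmonomial (a * b) (m + p) (n + q) := by
  refine lcoeff_ext fun i j => ?_
  rw [lcoeff_lmonomial_mul, lmonomial, lmonomial, lcoeff_lseries, lcoeff_lseries]
  by_cases h : i = m + p ∧ j = n + q
  · rw [if_pos h, if_pos (by omega)]
  · rw [if_neg h, if_neg (by omega), mul_zero]

theorem lmonomial_one : lmonomial 1 0 0 = 1 := by
  have h : ∀ x, lmonomial 1 0 0 * x = x := fun x => lcoeff_ext fun i j => by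
    rw [lcoeff_lmonomial_mul, sub_zero, sub_zero, one_mul]
  simpa using h 1

/-- The expansion of `(z₁ - z₂)^{-1-c}`, namely `∑_{m ≥ c} binom(m, c) z₁^{-1-m} z₂^{m-c}`. -/
def diffInv (c : ℕ) : IterLaurent :=
  lseries (fun i j => if 0 ≤ j ∧ i = -1 - j - c then (((j.toNat + c).choose c : ℕ) : ℂ) else 0)
    ⟨0, fun j hj i => if_neg (by omega)⟩ fun j => ⟨-1 - j - c, fun i hi => if_neg (by omega)⟩

theorem lcoeff_diffInv (c : ℕ) (i j : ℤ) : lcoeff (diffInv c) i j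
    = if 0 ≤ j ∧ i = -1 - j - c then (((j.toNat + c).choose c : ℕ) : ℂ) else 0 := rfl

theorem diff_mul_diffInv_zero : (lmonomial 1 1 0 - lmonomial 1 0 1) * diffInv 0 = 1 := by
  refine lcoeff_ext fun i j => ?_
  rw [sub_mul, lcoeff_sub, lcoeff_lmonomial_mul, lcoeff_lmonomial_mul, lcoeff_diffInv,
    lcoeff_diffInv, ← lmonomial_one, lmonomial, lcoeff_lseries]
  simp only [Nat.choose_zero_right, Nat.cast_zero, Nat.cast_one]
  split_ifs <;> first | omega | simp

theorem diff_mul_diffInv_succ (c : ℕ) :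
    (lmonomial 1 1 0 - lmonomial 1 0 1) * diffInv (c + 1) = diffInv c := by
  refine lcoeff_ext fun i j => ?_
  rw [sub_mul, lcoeff_sub, lcoeff_lmonomial_mul, lcoeff_lmonomial_mul, lcoeff_diffInv,
    lcoeff_diffInv, lcoeff_diffInv, one_mul, one_mul]
  by_cases hi : i = -1 - j - c
  · subst hi
    rcases lt_trichotomy j 0 with hj | rfl | hj
    · rw [if_neg (by omega), if_neg (by omega), if_neg (by omega), sub_zero]
    · simp only [le_refl, sub_zero, Int.toNat_zero, zero_add, Nat.choose_self, true_and]
      rw [if_pos (by push_cast; omega), if_neg (by omega)]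
      simp
    · obtain ⟨n, rfl⟩ : ∃ n : ℕ, j = (n : ℤ) + 1 := ⟨(j - 1).toNat, by omega⟩
      rw [if_pos (by push_cast; omega), if_pos (by push_cast; omega), if_pos (by omega)]
      have e1 : ((n : ℤ) + 1 - 0).toNat = n + 1 := by omega
      have e1' : ((n : ℤ) + 1).toNat = n + 1 := by omega
      have e2 : ((n : ℤ) + 1 - 1).toNat = n := by omega
      rw [e1, e1', e2, sub_eq_iff_eq_add, ← Nat.cast_add]
      congr 1
      have := Nat.choose_succ_succ (n + c + 1) c
      have e3 : n + 1 + (c + 1) = n + c + 1 + 1 := by ring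
      have e4 : n + 1 + c = n + c + 1 := by ring
      have e5 : n + (c + 1) = n + c + 1 := by ring
      rw [e3, e4, e5]
      exact this
  · rw [if_neg (by push_cast; omega), if_neg (by push_cast; omega), if_neg (by omega), sub_zero]

theorem diffInv_eq (c : ℕ) :
    diffInv c = ((lmonomial 1 1 0 - lmonomial 1 0 1)⁻¹) ^ (c + 1) := by
  have h0 : lmonomial 1 1 0 - lmonomial 1 0 1 ≠ 0 := fun h => by
    have := diff_mul_diffInv_zero
    rw [h, zero_mul] at this
    exact zero_ne_one this
  induction c with
  | zero =>
    rw [zero_add, pow_one]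
    exact eq_inv_of_mul_eq_one_right diff_mul_diffInv_zero
  | succ c ih =>
    rw [pow_succ, ← ih, ← diff_mul_diffInv_succ c]
    field_simp

/-- The coefficients of `(z₁ - z₂)^{-1-c} x`; the sum over `m` is cut off where the coefficients
of `x` vanish. -/
theorem lcoeff_diffInv_mul (c : ℕ) (x : IterLaurent) (i j : ℤ) :
    ∀ᶠ N in Filter.atTop, lcoeff (diffInv c * x) i j
      = ∑ m ∈ Finset.range N, (m.choose c : ℂ) * lcoeff x (i + 1 + m) (j + c - m) := by
  obtain ⟨B, hB⟩ := laurent_coeff_eq_zero (R := LaurentSeries ℂ) x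
  filter_upwards [Filter.eventually_ge_atTop ((j + c - B).toNat + 1)] with N hN
  have hinj : Set.InjOn (fun m : ℕ => ((-1 - m : ℤ), (m - c : ℤ))) (Finset.range N : Set ℕ) := by
    intro a _ b _ h
    simp only [Prod.mk.injEq] at h
    omega
  rw [lcoeff_mul, finsum_eq_sum_of_support_subset
    (s := (Finset.range N).image fun m : ℕ => ((-1 - m : ℤ), (m - c : ℤ))),
    Finset.sum_image hinj]
  · refine Finset.sum_congr rfl fun m _ => ?_
    rw [lcoeff_diffInv]
    have e1 : i - (-1 - m) = i + 1 + m := by ring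
    have e2 : j - (m - c) = j + c - m := by ring
    rw [e1, e2]
    congr 1
    by_cases hm : c ≤ m
    · rw [if_pos (by omega)]
      congr 2
      omega
    · rw [if_neg (by omega), Nat.choose_eq_zero_of_lt (by omega), Nat.cast_zero]
  · rintro ⟨a, b⟩ hab
    rw [Function.mem_support, lcoeff_diffInv] at hab
    have h1 : 0 ≤ b ∧ a = -1 - b - c := by
      by_contra h
      simp [h] at hab
    have h2 : B ≤ j - b := by
      by_contra h
      refine hab ?_
      rw [lcoeff, hB _ (by omega), HahnSeries.coeff_zero, mul_zero]
    simp only [Finset.coe_image, Set.mem_image, Finset.coe_range, Set.mem_Iio, Prod.mk.injEq]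
    refine ⟨(b + c).toNat, ?_, ?_, ?_⟩ <;> omega

theorem lcoeff_diffInv_mul' (c : ℕ) (x : IterLaurent) (i j : ℤ) :
    ∀ᶠ N in Filter.atTop, lcoeff (diffInv c * x) i j
      = ∑ a ∈ Finset.range N,
        ((a + c).choose c : ℂ) * lcoeff x (i + 1 + c + a) (j - a) := by
  filter_upwards [(Filter.tendsto_add_atTop_nat c).eventually (lcoeff_diffInv_mul c x i j)]
    with N hN
  rw [hN, add_comm N c, Finset.sum_range_add, Finset.sum_eq_zero, zero_add]
  · refine Finset.sum_congr rfl fun a _ => ?_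
    have e1 : i + 1 + (c + a : ℕ) = i + 1 + c + a := by push_cast; ring
    have e2 : j + c - (c + a : ℕ) = j - a := by push_cast; ring
    rw [e1, e2, add_comm c a]
  · intro m hm
    rw [Nat.choose_eq_zero_of_lt (Finset.mem_range.1 hm), Nat.cast_zero, zero_mul]

/-! ### The ring of expanded coefficients -/

/-- The expansion homomorphism `expand` into the field `ℂ((z₁))((z₂))`. -/
def expandHom : CoeffRing →+* IterLaurent := expand

/-- The image of `ℂ[z₁^{±1}, z₂^{±1}, (z₁ - z₂)⁻¹]` in `ℂ((z₁))((z₂))`. -/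
abbrev expandRange : Subring IterLaurent := expandHom.range

instance : IsNoetherianRing CoeffRing :=
  IsLocalization.isNoetherianRing (Submonoid.powers
    (MvPolynomial.X 0 * MvPolynomial.X 1 * (MvPolynomial.X 0 - MvPolynomial.X 1) :
      MvPolynomial (Fin 2) ℂ)) _ inferInstance

instance : IsNoetherianRing expandRange := isNoetherianRing_range expandHom

/-- The inclusion `ℂ[z₁, z₂] → ℂ((z₁))((z₂))`. -/
def polyHom : MvPolynomial (Fin 2) ℂ →+* IterLaurent :=
  expandHom.comp (algebraMap _ CoeffRing)

theorem polyHom_eq (f : MvPolynomial (Fin 2) ℂ) : polyHom f = polyExpand f := by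
  have h : expand (algebraMap _ CoeffRing f) = polyExpand f := by
    unfold expand
    exact IsLocalization.Away.lift_eq _ polyExpand_isUnit f
  exact h

theorem polyHom_mem (f : MvPolynomial (Fin 2) ℂ) : polyHom f ∈ expandRange := ⟨_, rfl⟩

theorem polyHom_inv_mem {f : MvPolynomial (Fin 2) ℂ}
    (hf : f ∣ MvPolynomial.X 0 * MvPolynomial.X 1 * (MvPolynomial.X 0 - MvPolynomial.X 1)) :
    (polyHom f)⁻¹ ∈ expandRange := by
  have hu : IsUnit (algebraMap (MvPolynomial (Fin 2) ℂ) CoeffRing f) :=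
    isUnit_of_dvd_unit (map_dvd _ hf) (IsLocalization.Away.algebraMap_isUnit _)
  obtain ⟨g, hg⟩ := hu.exists_right_inv
  refine ⟨g, eq_inv_of_mul_eq_one_right ?_⟩
  rw [polyHom, RingHom.comp_apply, ← map_mul, hg, map_one]

theorem lcoeff_coeff_single (a : ℂ) (m n i j : ℤ) :
    lcoeff (HahnSeries.single n (HahnSeries.single m a) : LaurentSeries (LaurentSeries ℂ)) i j
      = if i = m ∧ j = n then a else 0 := by
  unfold lcoeff
  rw [HahnSeries.coeff_single]
  by_cases hj : j = n
  · rw [if_pos hj, HahnSeries.coeff_single]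
    by_cases hi : i = m <;> simp [hi, hj]
  · simp [hj]

theorem polyHom_X_zero : polyHom (MvPolynomial.X 0) = lmonomial 1 1 0 := by
  have : polyExpand (MvPolynomial.X 0) = lz₁ := by simp [polyExpand]
  rw [polyHom_eq, this]
  exact lcoeff_ext fun i j => lcoeff_coeff_single 1 1 0 i j

theorem polyHom_X_one : polyHom (MvPolynomial.X 1) = lmonomial 1 0 1 := by
  have : polyExpand (MvPolynomial.X 1) = lz₂ := by simp [polyExpand]
  rw [polyHom_eq, this]
  exact lcoeff_ext fun i j => lcoeff_coeff_single 1 0 1 i j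

theorem polyHom_C (a : ℂ) : polyHom (MvPolynomial.C a) = lmonomial a 0 0 := by
  have : polyExpand (MvPolynomial.C a) = HahnSeries.C (HahnSeries.C a) := by simp [polyExpand]
  rw [polyHom_eq, this]
  exact lcoeff_ext fun i j => lcoeff_coeff_single a 0 0 i j

theorem zpow_mem_of_inv_mem {x : IterLaurent} (hx : x ∈ expandRange) (hx' : x⁻¹ ∈ expandRange)
    (a : ℤ) : x ^ a ∈ expandRange := by
  cases a with
  | ofNat n => rw [Int.ofNat_eq_natCast, zpow_natCast]; exact pow_mem hx n
  | negSucc n => rw [zpow_negSucc, ← inv_pow]; exact pow_mem hx' _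

theorem lmonomial_inv (m n : ℤ) : (lmonomial 1 m n)⁻¹ = lmonomial 1 (-m) (-n) := by
  refine (eq_inv_of_mul_eq_one_right ?_).symm
  rw [lmonomial_mul, add_neg_cancel, add_neg_cancel, one_mul, lmonomial_one]

theorem lmonomial_pow (m n : ℤ) (k : ℕ) : lmonomial 1 m n ^ k = lmonomial 1 (k * m) (k * n) := by
  induction k with
  | zero => simp [lmonomial_one]
  | succ k ih =>
    rw [pow_succ, ih, lmonomial_mul, one_mul]
    push_cast
    rw [add_mul, add_mul, one_mul, one_mul]

theorem lmonomial_zpow (m n k : ℤ) : lmonomial 1 m n ^ k = lmonomial 1 (k * m) (k * n) := by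
  cases k with
  | ofNat k => rw [Int.ofNat_eq_natCast, zpow_natCast, lmonomial_pow]
  | negSucc k =>
    rw [zpow_negSucc, lmonomial_pow, lmonomial_inv, Int.negSucc_eq]
    push_cast
    rw [neg_mul, neg_mul]

theorem lmonomial_mem (a : ℂ) (m n : ℤ) : lmonomial a m n ∈ expandRange := by
  have h : lmonomial a m n = lmonomial a 0 0 * (lmonomial 1 1 0 ^ m * lmonomial 1 0 1 ^ n) := by
    rw [lmonomial_zpow, lmonomial_zpow, lmonomial_mul, lmonomial_mul]
    simp
  rw [h, ← polyHom_C, ← polyHom_X_zero, ← polyHom_X_one]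
  refine mul_mem (polyHom_mem _) (mul_mem ?_ ?_)
  · exact zpow_mem_of_inv_mem (polyHom_mem _)
      (polyHom_inv_mem (Dvd.intro _ (mul_assoc _ _ _).symm)) m
  · exact zpow_mem_of_inv_mem (polyHom_mem _)
      (polyHom_inv_mem (Dvd.intro_left _ rfl |>.mul_right _)) n

theorem diffInv_mem (c : ℕ) : diffInv c ∈ expandRange := by
  rw [diffInv_eq, ← polyHom_X_zero, ← polyHom_X_one, ← map_sub]
  exact pow_mem (polyHom_inv_mem (Dvd.intro_left _ rfl)) _

instance : Module ℂ IterLaurent := Module.compHom IterLaurent (polyHom.comp MvPolynomial.C)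

theorem smul_eq_lmonomial_mul (a : ℂ) (x : IterLaurent) : a • x = lmonomial a 0 0 * x := by
  rw [← polyHom_C]
  rfl

@[simp] theorem lcoeff_smul (a : ℂ) (x : IterLaurent) (i j : ℤ) :
    lcoeff (a • x) i j = a * lcoeff x i j := by
  rw [smul_eq_lmonomial_mul, lcoeff_lmonomial_mul, sub_zero, sub_zero]

/-! ### The commutator and iterate formulas for logarithmic intertwining operators -/

theorem ringChoose_zero_eq_zero {i : ℕ} (hi : i ≠ 0) : Ring.choose (0 : ℤ) i = 0 := by
  have := Ring.choose_natCast (R := ℤ) 0 i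
  simp only [Nat.cast_zero] at this
  rw [this, Nat.choose_eq_zero_of_lt (Nat.pos_of_ne_zero hi), Nat.cast_zero]

/-- `binom(-1-a, c) = (-1)^c binom(a+c, c)`. -/
theorem ringChoose_neg (a c : ℕ) :
    Ring.choose (-1 - a : ℤ) c = (-1) ^ c * ((a + c).choose c : ℕ) := by
  have h := Ring.choose_neg (1 + a : ℤ) c
  have e : (1 + a : ℤ) + c - 1 = ((a + c : ℕ) : ℤ) := by push_cast; ring
  rw [e, Ring.choose_natCast] at h
  rw [show (-1 - a : ℤ) = -(1 + a) by ring, h, Units.smul_def, Int.negOnePow_def]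
  simp

theorem ringChoose_neg_one (i : ℕ) : (-1) ^ i * Ring.choose (-1 : ℤ) i = 1 := by
  have := ringChoose_neg 0 i
  simp only [Nat.cast_zero, sub_zero, zero_add, Nat.choose_self, Nat.cast_one, mul_one] at this
  rw [this, ← mul_pow]
  simp

theorem finsum_nat_eq_sum_range {E : Type*} [AddCommMonoid E] {f : ℕ → E} {N : ℕ}
    (h : ∀ i ≥ N, f i = 0) : ∑ᶠ i, f i = ∑ i ∈ Finset.range N, f i :=
  finsum_eq_sum_of_support_subset _ fun i hi => by
    simp only [Finset.coe_range, Set.mem_Iio]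
    by_contra hc
    exact hi (h i (not_lt.1 hc))

section Operators

variable {U W₁ W₂ W₃ : Type*} [AddCommGroup U] [Module ℂ U] [AddCommGroup W₁] [Module ℂ W₁]
  [AddCommGroup W₂] [Module ℂ W₂] [AddCommGroup W₃] [Module ℂ W₃]
  {ω : U} {Y₁ : Modes U W₁} {Y₂ : Modes U W₂} {Y₃ : Modes U W₃} {𝒴 : LogModes W₁ W₂ W₃}

/-- `u_m 𝒴(w₁, x) - 𝒴(w₁, x) u_m = ∑_i binom(m, i) x^{m-i} 𝒴(u_i w₁, x)`. -/
theorem IsLogIntertwining.commutator (h : IsLogIntertwining ω Y₁ Y₂ Y₃ 𝒴) {u : U} {w₁ : W₁}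
    {N : ℕ} (hN : ∀ i : ℕ, N ≤ i → Y₁ i u w₁ = 0) (w₂ : W₂) (m : ℤ) (n : ℂ) (k : ℕ) :
    Y₃ m u (𝒴 n k w₁ w₂) = 𝒴 n k w₁ (Y₂ m u w₂)
      + ∑ i ∈ Finset.range N, ((Ring.choose m i : ℤ) : ℂ) • 𝒴 (n + m - i) k (Y₁ i u w₁) w₂ := by
  have hj := h.jacobi k u w₁ w₂ 0 m n
  rw [finsum_eq_single _ 0 (fun i hi => by simp [ringChoose_zero_eq_zero hi]),
    finsum_eq_single _ 0 (fun i hi => by simp [ringChoose_zero_eq_zero hi]),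
    finsum_nat_eq_sum_range (N := N) (fun i hi => by simp [hN i hi])] at hj
  simp only [pow_zero, Ring.choose_zero_right, mul_one, one_smul, Int.cast_zero, add_zero,
    Nat.cast_zero, sub_zero, Int.negOnePow_zero, Units.val_one, zero_add] at hj
  simp only [Int.cast_smul_eq_zsmul]
  rw [← hj]
  abel

/-- `𝒴(u_{-1}w₁, x) = ∑_i x^i u_{-1-i} 𝒴(w₁, x) + ∑_i x^{-1-i} 𝒴(w₁, x) u_i`. -/
theorem IsLogIntertwining.iterate (h : IsLogIntertwining ω Y₁ Y₂ Y₃ 𝒴) {u : U} {w₁ : W₁}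
    {w₂ : W₂} {n : ℂ} {k : ℕ} {N N' : ℕ} (hN : ∀ i : ℕ, N ≤ i → 𝒴 (n + i) k w₁ w₂ = 0)
    (hN' : ∀ i : ℕ, N' ≤ i → Y₂ i u w₂ = 0) :
    𝒴 n k (Y₁ (-1) u w₁) w₂
      = ∑ i ∈ Finset.range N, Y₃ (-1 - i) u (𝒴 (n + i) k w₁ w₂)
        + ∑ i ∈ Finset.range N', 𝒴 (n - 1 - i) k w₁ (Y₂ i u w₂) := by
  have hj := h.jacobi k u w₁ w₂ (-1) 0 n
  rw [finsum_nat_eq_sum_range (N := N) (fun i hi => by simp [hN i hi]),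
    finsum_nat_eq_sum_range (N := N') (fun i hi => by simp [hN' i hi]),
    finsum_eq_single _ 0 (fun i hi => by simp [ringChoose_zero_eq_zero hi])] at hj
  have e : ((-1 : ℤ).negOnePow : ℤ) = -1 := by simp
  simp only [e, mul_assoc, ringChoose_neg_one, mul_one, neg_smul, Finset.sum_neg_distrib,
    sub_neg_eq_add, zero_add, Ring.choose_zero_right, Nat.cast_zero, Int.cast_zero, add_zero,
    sub_zero, Int.cast_neg, Int.cast_one, one_smul, ← sub_eq_add_neg] at hj
  exact hj.symm

theorem LowerTruncation.exists_nat {Y : Modes U W₁} (h : LowerTruncation Y) (u : U) (w : W₁)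
    (m : ℤ) : ∃ N : ℕ, ∀ i : ℕ, N ≤ i → Y (m + i) u w = 0 := by
  obtain ⟨N, hN⟩ := h u w
  exact ⟨(N - m).toNat, fun i hi => hN _ (by omega)⟩

theorem LowerTruncation.exists_nat' {Y : Modes U W₁} (h : LowerTruncation Y) (u : U) (w : W₁) :
    ∃ N : ℕ, ∀ i : ℕ, N ≤ i → Y i u w = 0 := by
  simpa using h.exists_nat u w 0

end Operators

/-! ### Modes on the contragredient -/

section Contragredient

variable {At : Type*} [AddCommGroup At] {A : AddSubgroup At}
  {V : Type*} [AddCommGroup V] [Module ℂ V] {𝒱 : StronglyGradedCVA A V}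
  {W : Type*} [AddCommGroup W] [Module ℂ W]

theorem contragredient_apply (M : StronglyGradedGenModule 𝒱 W) (n : ℤ) (v : V)
    (f : restrictedDual M) (w : W) :
    ((contragredient M).Y n v f : Module.Dual ℂ W) w
      = (f : Module.Dual ℂ W) (oppositeMode M n v w) := rfl

theorem oppositeMode_apply_of_mem (M : StronglyGradedGenModule 𝒱 W) {h : ℤ} {v : V}
    (hv : v ∈ 𝒱.wt h) {J : ℕ} (hJ : ∀ j ≥ J, (vir 𝒱.Y 𝒱.ω 1 ^ j) v = 0) (n : ℤ) :
    oppositeMode M n v = ∑ j ∈ Finset.range J, (((-1 : ℂ) ^ h) * ((j.factorial : ℂ))⁻¹) •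
      M.Y (2 * h - n - 2 - j) ((vir 𝒱.Y 𝒱.ω 1 ^ j) v) := by
  rw [oppositeMode_of_mem M hv, oppositeModeFun,
    finsum_nat_eq_sum_range (N := J) (fun i hi => by simp [hJ i hi])]

/-- For a fixed `w`, `v_n^o w = 0` when `n` is sufficiently negative. -/
theorem oppositeMode_truncation (M : StronglyGradedGenModule 𝒱 W) {h : ℤ} {v : V}
    (hv : v ∈ 𝒱.wt h) (w : W) :
    ∃ N : ℕ, ∀ i : ℕ, N ≤ i → oppositeMode M (-1 - i) v w = 0 := by
  obtain ⟨J, hJ⟩ := L_one_nilpotent (𝒱 := 𝒱) v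
  choose N hN using fun j : ℕ => M.lower_truncation.exists_nat ((vir 𝒱.Y 𝒱.ω 1 ^ j) v) w
    (2 * h - 1 - j)
  refine ⟨∑ j ∈ Finset.range J, N j, fun i hi => ?_⟩
  rw [oppositeMode_apply_of_mem M hv hJ, LinearMap.sum_apply]
  refine Finset.sum_eq_zero fun j hj => ?_
  have h1 : N j ≤ i := (Finset.single_le_sum (fun _ _ => Nat.zero_le _) hj).trans hi
  have := hN j i h1
  rw [show (2 * h - 1 - j + i : ℤ) = 2 * h - (-1 - i) - 2 - j by ring] at this
  rw [LinearMap.smul_apply, this, smul_zero]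

/-- Taking the opposite vertex operator twice gives back the vertex operator:
`u_n = (-1)^h ∑_j (1/j!) (L(1)^j u)^o_{2h-n-2-j}` for `u ∈ V_(h)`. -/
theorem mode_eq_sum_oppositeMode (M : StronglyGradedGenModule 𝒱 W) {h : ℤ} {u : V} {α : A}
    (hu : u ∈ 𝒱.wt h ⊓ 𝒱.gr α) {J : ℕ} (hJ : ∀ j ≥ J, (vir 𝒱.Y 𝒱.ω 1 ^ j) u = 0) (n : ℤ) :
    M.Y n u = ∑ j ∈ Finset.range J, (((-1 : ℂ) ^ h) * ((j.factorial : ℂ))⁻¹) •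
      oppositeMode M (2 * h - n - 2 - j) ((vir 𝒱.Y 𝒱.ω 1 ^ j) u) := by
  set L := vir 𝒱.Y 𝒱.ω 1 with hL
  have hsq : ((-1 : ℂ) ^ h) * (-1 : ℂ) ^ h = 1 := by
    rw [← mul_zpow]; simp
  have h1 : ∀ j : ℕ, (((-1 : ℂ) ^ h) * ((j.factorial : ℂ))⁻¹) •
      oppositeMode M (2 * h - n - 2 - j) ((L ^ j) u)
      = ∑ i ∈ Finset.range J, ((-1 : ℂ) ^ j * (j.factorial : ℂ)⁻¹ * (i.factorial : ℂ)⁻¹) •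
        M.Y (n - (i + j : ℕ)) ((L ^ (i + j)) u) := by
    intro j
    rw [oppositeMode_apply_of_mem M (L_one_pow_mem hu j).1 (J := J) ?_, Finset.smul_sum]
    · refine Finset.sum_congr rfl fun i _ => ?_
      rw [smul_smul, ← Module.End.mul_apply, ← hL, ← pow_add]
      have e : (2 * (h - j) - (2 * h - n - 2 - j) - 2 - i : ℤ) = n - (i + j : ℕ) := by
        push_cast; ring
      rw [e]
      congr 1
      have e2 : (-1 : ℂ) ^ (h - j : ℤ) = (-1) ^ h * (-1) ^ j := by
        rw [zpow_sub₀ (by norm_num), zpow_natCast, div_eq_mul_inv, ← inv_pow]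
        norm_num
      rw [e2]
      linear_combination ((-1 : ℂ) ^ j * (j.factorial : ℂ)⁻¹ * (i.factorial : ℂ)⁻¹) * hsq
    · intro i hi
      rw [← Module.End.mul_apply, ← hL, ← pow_add]
      exact hJ _ (by omega)
  rw [Finset.sum_congr rfl fun j _ => h1 j]
  -- Collect the terms with `i + j = s`; the binomial theorem for `(1 - 1)^s` leaves only `s = 0`.
  have h2 : ∀ s : ℕ, (∑ p ∈ Finset.HasAntidiagonal.antidiagonal s,
      ((-1 : ℂ) ^ p.1 * (p.1.factorial : ℂ)⁻¹ * (p.2.factorial : ℂ)⁻¹))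
        = if s = 0 then 1 else 0 := by
    intro s
    have hb := (Commute.all (-1 : ℂ) 1).add_pow' s
    have : ∀ p ∈ Finset.HasAntidiagonal.antidiagonal s, ((-1 : ℂ) ^ p.1 * (p.1.factorial : ℂ)⁻¹ *
        (p.2.factorial : ℂ)⁻¹)
          = (s.factorial : ℂ)⁻¹ * (s.choose p.1 • ((-1) ^ p.1 * 1 ^ p.2)) := by
      intro p hp
      rw [Finset.HasAntidiagonal.mem_antidiagonal] at hp
      subst hp
      have hc := Nat.add_choose_mul_factorial_mul_factorial p.1 p.2
      rw [← Nat.choose_symm_add] at hc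
      have hc' : ((p.1 + p.2).choose p.1 : ℂ) * p.1.factorial * p.2.factorial
          = (p.1 + p.2).factorial := by exact_mod_cast hc
      have f1 : (p.1.factorial : ℂ) ≠ 0 := by exact_mod_cast p.1.factorial_ne_zero
      have f2 : (p.2.factorial : ℂ) ≠ 0 := by exact_mod_cast p.2.factorial_ne_zero
      have f3 : ((p.1 + p.2).factorial : ℂ) ≠ 0 := by
        exact_mod_cast (p.1 + p.2).factorial_ne_zero
      rw [nsmul_eq_mul, one_pow, mul_one]
      field_simp
      rw [← hc']
      ring
    rw [Finset.sum_congr rfl this, ← Finset.mul_sum, ← hb, neg_add_cancel]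
    rcases Nat.eq_zero_or_pos s with rfl | hs
    · simp
    · rw [zero_pow hs.ne', mul_zero, if_neg hs.ne']
  have h3 : ∑ j ∈ Finset.range J, ∑ i ∈ Finset.range J,
      ((-1 : ℂ) ^ j * (j.factorial : ℂ)⁻¹ * (i.factorial : ℂ)⁻¹) •
        M.Y (n - (i + j : ℕ)) ((L ^ (i + j)) u)
      = ∑ s ∈ Finset.range (2 * J), ∑ p ∈ Finset.HasAntidiagonal.antidiagonal s,
        ((-1 : ℂ) ^ p.1 * (p.1.factorial : ℂ)⁻¹ * (p.2.factorial : ℂ)⁻¹) •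
          M.Y (n - (s : ℕ)) ((L ^ s) u) := by
    rw [← Finset.sum_product', Finset.sum_sigma']
    refine Finset.sum_bij_ne_zero (fun p _ _ => ⟨p.1 + p.2, p⟩) ?_ ?_ ?_ ?_
    · rintro ⟨j, i⟩ hp _
      simp only [Finset.mem_product, Finset.mem_range] at hp
      simp only [Finset.mem_sigma, Finset.mem_range, Finset.HasAntidiagonal.mem_antidiagonal,
        and_true]
      omega
    · intro p _ _ q _ _ hpq
      exact eq_of_heq (Sigma.mk.inj hpq).2
    · rintro ⟨s, j, i⟩ hp hne
      simp only [Finset.mem_sigma, Finset.mem_range, Finset.HasAntidiagonal.mem_antidiagonal] at hp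
      obtain ⟨hs, rfl⟩ := hp
      have hlt : j + i < J := by
        by_contra hc
        exact hne (by simp [hJ _ (not_lt.1 hc)])
      refine ⟨(j, i), ?_, ?_, rfl⟩
      · simp only [Finset.mem_product, Finset.mem_range]; omega
      · rw [add_comm i j]
        exact hne
    · rintro ⟨j, i⟩ _ _
      rw [add_comm i j]
  rw [h3]
  simp_rw [← Finset.sum_smul, h2]
  rcases Nat.eq_zero_or_pos J with rfl | hJ'
  · have : u = 0 := by simpa using hJ 0 le_rfl
    simp [this]
  · rw [Finset.sum_eq_single 0]
    · simp
    · intro s _ hs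
      rw [if_neg hs, zero_smul]
    · intro hc
      exact absurd (Finset.mem_range.2 (by omega)) hc

end Contragredient

/-! ### The matrix elements as families of iterated Laurent series -/

/-- A formal series in complex powers of `z₁, z₂` and powers of their logarithms, truncated below,
is recorded by its values `F p q k l ∈ ℂ((z₁))((z₂))`: the coefficient of `z₁^i z₂^j` in `F p q k l`
is the coefficient of `z₁^{p+i} z₂^{q+j} (log z₁)^k (log z₂)^l` in the series. The action of
`ℂ((z₁))((z₂))` on such series is then multiplication in each place. -/
abbrev SeriesSpace : Type := ℂ → ℂ → ℕ → ℕ → IterLaurent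

theorem SeriesSpace.ext {F G : SeriesSpace}
    (h : ∀ p q k l i j, lcoeff (F p q k l) i j = lcoeff (G p q k l) i j) : F = G := by
  funext p q k l
  exact lcoeff_ext (h p q k l)

section

variable {At : Type*} [AddCommGroup At] {A : AddSubgroup At}
  {V : Type*} [AddCommGroup V] [Module ℂ V] {𝒱 : StronglyGradedCVA A V}
  {W₀ W₁ W₂ W₃ W₄ : Type*} [AddCommGroup W₀] [Module ℂ W₀]
  [AddCommGroup W₁] [Module ℂ W₁] [AddCommGroup W₂] [Module ℂ W₂] [AddCommGroup W₃] [Module ℂ W₃]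
  [AddCommGroup W₄] [Module ℂ W₄]
  {M₀ : StronglyGradedGenModule 𝒱 W₀} {M₁ : StronglyGradedGenModule 𝒱 W₁}
  {M₂ : StronglyGradedGenModule 𝒱 W₂} {M₃ : StronglyGradedGenModule 𝒱 W₃}
  {M₄ : StronglyGradedGenModule 𝒱 W₄}
  {𝒴₁ : LogModes W₁ W₄ ↥(restrictedDual M₀)} {𝒴₂ : LogModes W₂ W₃ W₄}

section Truncation

variable {U X₁ X₂ X₃ : Type*} [AddCommGroup U] [Module ℂ U] [AddCommGroup X₁] [Module ℂ X₁]
  [AddCommGroup X₂] [Module ℂ X₂] [AddCommGroup X₃] [Module ℂ X₃]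
  {ω : U} {Y₁ : Modes U X₁} {Y₂ : Modes U X₂} {Y₃ : Modes U X₃} {𝒴 : LogModes X₁ X₂ X₃}

theorem IsLogIntertwining.exists_lt (h : IsLogIntertwining ω Y₁ Y₂ Y₃ 𝒴) (w₁ : X₁) (w₂ : X₂)
    (p : ℂ) : ∃ N : ℤ, ∀ i < N, ∀ k, 𝒴 (-(p + i) - 1) k w₁ w₂ = 0 := by
  obtain ⟨N, hN⟩ := h.lower_truncation w₁ w₂ (-p - 1)
  refine ⟨-N, fun i hi k => ?_⟩
  have := hN (-i).toNat (by omega) k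
  have e : (((-i).toNat : ℕ) : ℂ) = -i := by
    rw [← Int.cast_natCast, Int.toNat_of_nonneg (by omega), Int.cast_neg]
  rw [e] at this
  rwa [show -(p + i) - 1 = -p - 1 + -(i : ℂ) by ring]

end Truncation

variable (h₁ : IsLogIntertwining 𝒱.ω M₁.Y M₄.Y (contragredient M₀).Y 𝒴₁)
  (h₂ : IsLogIntertwining 𝒱.ω M₂.Y M₃.Y M₄.Y 𝒴₂)

/-- The series `⟨w₀, 𝒴₁(w₁, z₁) 𝒴₂(w₂, z₂) w₃⟩` as an element of `SeriesSpace`. -/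
def matrixSeries (w₀ : W₀) (w₁ : W₁) (w₂ : W₂) (w₃ : W₃) : SeriesSpace := fun p q k l =>
  lseries (fun i j => matrixElement M₀ 𝒴₁ 𝒴₂ w₀ w₁ w₂ w₃ (p + i) (q + j) k l)
    (by
      obtain ⟨N, hN⟩ := h₂.exists_lt w₂ w₃ q
      exact ⟨N, fun j hj i => by simp only [matrixElement, hN j hj l, map_zero]; rfl⟩)
    (fun j => by
      obtain ⟨N, hN⟩ := h₁.exists_lt w₁ (𝒴₂ (-(q + j) - 1) l w₂ w₃) p
      exact ⟨N, fun i hi => by simp only [matrixElement, hN i hi k]; rfl⟩)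

/-- `matrixSeries` as a multilinear map. -/
def matrixMap : W₀ →ₗ[ℂ] W₁ →ₗ[ℂ] W₂ →ₗ[ℂ] W₃ →ₗ[ℂ] SeriesSpace :=
  LinearMap.mk₂ ℂ (fun w₀ w₁ => LinearMap.mk₂ ℂ (fun w₂ w₃ => matrixSeries h₁ h₂ w₀ w₁ w₂ w₃)
      (fun _ _ _ => SeriesSpace.ext fun p q k l i j => by simp [matrixSeries, matrixElement])
      (fun _ _ _ => SeriesSpace.ext fun p q k l i j => by simp [matrixSeries, matrixElement])
      (fun _ _ _ => SeriesSpace.ext fun p q k l i j => by simp [matrixSeries, matrixElement])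
      (fun _ _ _ => SeriesSpace.ext fun p q k l i j => by simp [matrixSeries, matrixElement]))
    (fun _ _ _ => LinearMap.ext₂ fun _ _ => SeriesSpace.ext fun p q k l i j => by
      simp [matrixSeries, matrixElement])
    (fun _ _ _ => LinearMap.ext₂ fun _ _ => SeriesSpace.ext fun p q k l i j => by
      simp [matrixSeries, matrixElement])
    (fun _ _ _ => LinearMap.ext₂ fun _ _ => SeriesSpace.ext fun p q k l i j => by
      simp [matrixSeries, matrixElement])
    (fun _ _ _ => LinearMap.ext₂ fun _ _ => SeriesSpace.ext fun p q k l i j => by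
      simp [matrixSeries, matrixElement])

theorem lcoeff_matrixMap (w₀ : W₀) (w₁ : W₁) (w₂ : W₂) (w₃ : W₃) (p q : ℂ) (k l : ℕ) (i j : ℤ) :
    lcoeff (matrixMap h₁ h₂ w₀ w₁ w₂ w₃ p q k l) i j
      = matrixElement M₀ 𝒴₁ 𝒴₂ w₀ w₁ w₂ w₃ (p + i) (q + j) k l := rfl

/-- Moving `u_m` from `w₃` to the left, where it becomes the opposite mode acting on `w₀`. -/
theorem matrixMap_mode₃ {u : V} {w₁ : W₁} {w₂ : W₂} {N : ℕ}
    (hN₁ : ∀ i : ℕ, N ≤ i → M₁.Y i u w₁ = 0) (hN₂ : ∀ i : ℕ, N ≤ i → M₂.Y i u w₂ = 0)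
    (w₀ : W₀) (w₃ : W₃) (m : ℤ) :
    matrixMap h₁ h₂ (oppositeMode M₀ m u w₀) w₁ w₂ w₃
      = matrixMap h₁ h₂ w₀ w₁ w₂ (M₃.Y m u w₃)
        + ∑ c ∈ Finset.range N, lmonomial (Ring.choose m c : ℤ) (m - c) 0 •
          matrixMap h₁ h₂ w₀ (M₁.Y c u w₁) w₂ w₃
        + ∑ c ∈ Finset.range N, lmonomial (Ring.choose m c : ℤ) 0 (m - c) •
          matrixMap h₁ h₂ w₀ w₁ (M₂.Y c u w₂) w₃ := by
  refine SeriesSpace.ext fun p q k l i j => ?_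
  simp only [Pi.add_apply, Finset.sum_apply, Pi.smul_apply, smul_eq_mul, lcoeff_add, lcoeff_sum,
    lcoeff_lmonomial_mul, lcoeff_matrixMap, matrixElement, ← contragredient_apply]
  rw [h₁.commutator hN₁, h₂.commutator hN₂]
  simp only [map_add, map_sum, map_smul, Submodule.coe_add, Submodule.coe_sum, Submodule.coe_smul,
    LinearMap.add_apply, LinearMap.sum_apply, LinearMap.smul_apply, smul_eq_mul]
  rw [add_assoc, add_assoc, add_comm (∑ c ∈ Finset.range N, _)]
  congr 2
  · refine Finset.sum_congr rfl fun c _ => ?_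
    congr 3
    push_cast
    ring_nf
  · refine Finset.sum_congr rfl fun c _ => ?_
    congr 3
    push_cast
    ring_nf

/-- Removing `u_{-1}` from `w₁`. Moving the modes `u_i` past `𝒴₂(w₂, z₂)` produces the sums
`∑_i binom(i, c) z₁^{-1-i} z₂^{i-c}`, which are the expansions of `(z₁ - z₂)^{-1-c}`. -/
theorem matrixMap_mode₁ {u : V} {w₀ : W₀} {w₂ : W₂} {w₃ : W₃} {N : ℕ}
    (hN₀ : ∀ i : ℕ, N ≤ i → oppositeMode M₀ (-1 - i) u w₀ = 0)
    (hN₂ : ∀ i : ℕ, N ≤ i → M₂.Y i u w₂ = 0) (hN₃ : ∀ i : ℕ, N ≤ i → M₃.Y i u w₃ = 0)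
    (w₁ : W₁) :
    matrixMap h₁ h₂ w₀ (M₁.Y (-1) u w₁) w₂ w₃
      = ∑ i ∈ Finset.range N, lmonomial 1 i 0 •
          matrixMap h₁ h₂ (oppositeMode M₀ (-1 - i) u w₀) w₁ w₂ w₃
        + ∑ i ∈ Finset.range N, lmonomial 1 (-1 - i) 0 •
          matrixMap h₁ h₂ w₀ w₁ w₂ (M₃.Y i u w₃)
        + ∑ c ∈ Finset.range N, diffInv c • matrixMap h₁ h₂ w₀ w₁ (M₂.Y c u w₂) w₃ := by
  refine SeriesSpace.ext fun p q k l i j => ?_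
  simp only [Pi.add_apply, Finset.sum_apply, Pi.smul_apply, smul_eq_mul, lcoeff_add, lcoeff_sum,
    lcoeff_lmonomial_mul]
  obtain ⟨B, hB⟩ := h₁.lower_truncation w₁ (𝒴₂ (-(q + j) - 1) l w₂ w₃) (-(p + i) - 1)
  obtain ⟨B', hB'⟩ := M₄.lower_truncation.exists_nat' u (𝒴₂ (-(q + j) - 1) l w₂ w₃)
  -- A bound beyond which all sums involved have no further terms.
  have hev : ∀ᶠ K in Filter.atTop, ∀ c ∈ Finset.range N,
      lcoeff (diffInv c * matrixMap h₁ h₂ w₀ w₁ (M₂.Y c u w₂) w₃ p q k l) i j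
        = ∑ m ∈ Finset.range K, (m.choose c : ℂ) *
          lcoeff (matrixMap h₁ h₂ w₀ w₁ (M₂.Y c u w₂) w₃ p q k l) (i + 1 + m) (j + c - m) :=
    (Filter.eventually_all_finset _).2 fun c _ => lcoeff_diffInv_mul c _ i j
  obtain ⟨K, hK, hKN, hKB, hKB'⟩ := (hev.and ((Filter.eventually_ge_atTop N).and
    ((Filter.eventually_ge_atTop B).and (Filter.eventually_ge_atTop B')))).exists
  rw [Finset.sum_congr rfl hK]
  simp only [lcoeff_matrixMap, matrixElement]
  rw [h₁.iterate (N := K) (N' := K) (fun i hi => hB i (hKB.trans hi) k)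
    (fun i hi => hB' i (hKB'.trans hi))]
  simp only [h₂.commutator hN₂, map_add, map_sum, map_smul, Submodule.coe_add, Submodule.coe_sum,
    Submodule.coe_smul, LinearMap.add_apply, LinearMap.sum_apply, LinearMap.smul_apply,
    smul_eq_mul, contragredient_apply, Finset.sum_add_distrib]
  rw [add_assoc]
  congr 1
  · rw [Finset.eventually_constant_sum (N := N) (fun i hi => by rw [hN₀ i hi, map_zero]) hKN]
    refine Finset.sum_congr rfl fun a _ => ?_
    push_cast
    ring_nf
  · congr 1
    · rw [Finset.eventually_constant_sum (N := N) (fun i hi => by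
        rw [hN₃ i hi, map_zero, map_zero]; rfl) hKN]
      refine Finset.sum_congr rfl fun a _ => ?_
      rw [one_mul]
      congr 3 <;> (push_cast; ring_nf)
    · rw [Finset.sum_comm]
      refine Finset.sum_congr rfl fun c _ => Finset.sum_congr rfl fun m _ => ?_
      rw [Ring.choose_natCast]
      congr 3
      push_cast
      ring_nf

/-- Removing `u_{-1}` from `w₂`. Moving the modes `u_{-1-i}` to the left past `𝒴₁(w₁, z₁)` produces
the sums `∑_i binom(-1-i, c) z₁^{-1-i-c} z₂^i`, the expansions of `(-1)^c (z₁ - z₂)^{-1-c}`. -/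
theorem matrixMap_mode₂ {u : V} {w₀ : W₀} {w₁ : W₁} {w₃ : W₃} {N : ℕ}
    (hN₀ : ∀ i : ℕ, N ≤ i → oppositeMode M₀ (-1 - i) u w₀ = 0)
    (hN₁ : ∀ i : ℕ, N ≤ i → M₁.Y i u w₁ = 0) (hN₃ : ∀ i : ℕ, N ≤ i → M₃.Y i u w₃ = 0)
    (w₂ : W₂) :
    matrixMap h₁ h₂ w₀ w₁ (M₂.Y (-1) u w₂) w₃
      = ∑ i ∈ Finset.range N, lmonomial 1 0 i •
          matrixMap h₁ h₂ (oppositeMode M₀ (-1 - i) u w₀) w₁ w₂ w₃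
        - ∑ c ∈ Finset.range N, lmonomial ((-1) ^ c) 0 0 • diffInv c •
          matrixMap h₁ h₂ w₀ (M₁.Y c u w₁) w₂ w₃
        + ∑ i ∈ Finset.range N, lmonomial 1 0 (-1 - i) •
          matrixMap h₁ h₂ w₀ w₁ w₂ (M₃.Y i u w₃) := by
  refine SeriesSpace.ext fun p q k l i j => ?_
  simp only [Pi.add_apply, Pi.sub_apply, Finset.sum_apply, Pi.smul_apply, smul_eq_mul, lcoeff_add,
    lcoeff_sub, lcoeff_sum, lcoeff_lmonomial_mul, sub_zero]
  obtain ⟨B, hB⟩ := h₂.lower_truncation w₂ w₃ (-(q + j) - 1)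
  have hev : ∀ᶠ K in Filter.atTop, ∀ c ∈ Finset.range N,
      (-1) ^ c * lcoeff (diffInv c * matrixMap h₁ h₂ w₀ (M₁.Y c u w₁) w₂ w₃ p q k l) i j
        = (-1) ^ c * ∑ a ∈ Finset.range K, ((a + c).choose c : ℂ) *
          lcoeff (matrixMap h₁ h₂ w₀ (M₁.Y c u w₁) w₂ w₃ p q k l) (i + 1 + c + a) (j - a) := by
    refine (Filter.eventually_all_finset _).2 fun c _ => ?_
    filter_upwards [lcoeff_diffInv_mul' c (matrixMap h₁ h₂ w₀ (M₁.Y c u w₁) w₂ w₃ p q k l) i j]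
      with K hK
    rw [hK]
  obtain ⟨K, hK, hKN, hKB⟩ := (hev.and ((Filter.eventually_ge_atTop N).and
    (Filter.eventually_ge_atTop B))).exists
  rw [Finset.sum_congr rfl hK]
  simp only [lcoeff_matrixMap, matrixElement]
  rw [h₂.iterate (N := K) (N' := N) (fun i hi => hB i (hKB.trans hi) l) hN₃]
  have hc := fun (m : ℤ) (n : ℂ) (y : W₄) => eq_sub_of_add_eq (h₁.commutator hN₁ y m n k).symm
  simp only [map_add, map_sum, hc, Submodule.coe_add, Submodule.coe_sum, Submodule.coe_sub,
    Submodule.coe_smul, LinearMap.add_apply, LinearMap.sum_apply, LinearMap.smul_apply,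
    LinearMap.sub_apply, smul_eq_mul, contragredient_apply, Finset.sum_sub_distrib]
  congr 1
  · congr 1
    · rw [Finset.eventually_constant_sum (N := N) (fun i hi => by rw [hN₀ i hi, map_zero]) hKN]
      refine Finset.sum_congr rfl fun a _ => ?_
      rw [one_mul]
      congr 4
      push_cast
      ring_nf
    · rw [Finset.sum_comm]
      refine Finset.sum_congr rfl fun c _ => ?_
      rw [Finset.mul_sum]
      refine Finset.sum_congr rfl fun a _ => ?_
      rw [ringChoose_neg, ← mul_assoc]
      congr 1
      · push_cast; ring
      · congr 3 <;> (push_cast; ring_nf)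
  · refine Finset.sum_congr rfl fun a _ => ?_
    rw [one_mul]
    congr 4
    push_cast
    ring_nf

theorem matrixElement_L_neg_one₁ (h₁ : IsLogIntertwining 𝒱.ω M₁.Y M₄.Y (contragredient M₀).Y 𝒴₁)
    (w₀ : W₀) (w₁ : W₁) (w₂ : W₂) (w₃ : W₃) :
    matrixElement M₀ 𝒴₁ 𝒴₂ w₀ (vir M₁.Y 𝒱.ω (-1) w₁) w₂ w₃
      = partial₁ (matrixElement M₀ 𝒴₁ 𝒴₂ w₀ w₁ w₂ w₃) := by
  funext p q k l
  simp only [matrixElement, partial₁, h₁.derivative, Submodule.coe_add, Submodule.coe_smul,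
    LinearMap.add_apply, LinearMap.smul_apply, smul_eq_mul]
  congr 2 <;> ring_nf

theorem matrixElement_L_neg_one₂ (h₂ : IsLogIntertwining 𝒱.ω M₂.Y M₃.Y M₄.Y 𝒴₂)
    (w₀ : W₀) (w₁ : W₁) (w₂ : W₂) (w₃ : W₃) :
    matrixElement M₀ 𝒴₁ 𝒴₂ w₀ w₁ (vir M₂.Y 𝒱.ω (-1) w₂) w₃
      = partial₂ (matrixElement M₀ 𝒴₁ 𝒴₂ w₀ w₁ w₂ w₃) := by
  funext p q k l
  simp only [matrixElement, partial₂, h₂.derivative, map_add, map_smul, Submodule.coe_add,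
    Submodule.coe_smul, LinearMap.add_apply, LinearMap.smul_apply, smul_eq_mul]
  congr 2 <;> ring_nf

end

/-! ### Homogeneous decomposition of `C₁(W)` -/

theorem mem_of_mem_iSup_of_iSupIndep {ι E : Type*} [AddCommGroup E] [Module ℂ E]
    {f g : ι → Submodule ℂ E} (hfg : ∀ i, f i ≤ g i) (hg : iSupIndep g) {i : ι} {x : E}
    (hx : x ∈ g i) (hxf : x ∈ ⨆ i, f i) : x ∈ f i := by
  have hx' : x ∈ f i ⊔ ⨆ (j) (_ : j ≠ i), f j := by
    refine (iSup_le fun j => ?_ : ⨆ j, f j ≤ _) hxf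
    by_cases h : j = i
    · subst h; exact le_sup_left
    · exact le_sup_of_le_right (le_iSup₂_of_le j h le_rfl)
  obtain ⟨a, ha, b, hb, rfl⟩ := Submodule.mem_sup.1 hx'
  have hb1 : b ∈ g i := by simpa using (g i).sub_mem hx (hfg i ha)
  have hb2 : b = 0 := Submodule.disjoint_def.1 (hg i) b hb1 ((iSup₂_mono fun j _ => hfg j) hb)
  simpa [hb2] using ha

section

variable {At : Type*} [AddCommGroup At] {A A₀ : AddSubgroup At}
  {V : Type*} [AddCommGroup V] [Module ℂ V] {𝒱 : StronglyGradedCVA A V} {V₀ : Submodule ℂ V}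
  {W : Type*} [AddCommGroup W] [Module ℂ W]

/-- The span of the elements `u_{-1}w` of weight `q` and degree `γ` with homogeneous `u` of positive
weight and degree in `A₀`, and homogeneous `w`. -/
def c₁Piece (A₀ : AddSubgroup At) (M : StronglyGradedGenModule 𝒱 W) (γ : At) (q : ℂ) :
    Submodule ℂ W :=
  Submodule.span ℂ {x | ∃ (α : A) (h : ℤ), (α : At) ∈ A₀ ∧ 0 < h ∧ ∃ u ∈ 𝒱.wt h ⊓ 𝒱.gr α,
    ∃ w ∈ M.wt (q - h) ⊓ M.gr (γ - α), x = M.Y (-1) u w}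

theorem c₁Piece_le (M : StronglyGradedGenModule 𝒱 W) (γ : At) (q : ℂ) :
    c₁Piece A₀ M γ q ≤ M.wt q ⊓ M.gr γ := by
  refine Submodule.span_le.2 ?_
  rintro _ ⟨α, h, -, -, u, hu, w, hw, rfl⟩
  refine ⟨?_, ?_⟩
  · have := mode_mem_wt M (n := -1) hu.1 hw.1
    rwa [show q - h + h - ((-1 : ℤ) : ℂ) - 1 = q by push_cast; ring] at this
  · have := M.gr_Y α (γ - α) (-1) u hu.2 w hw.2
    rwa [add_sub_cancel] at this

theorem positivePart_le (hV₀ : IsStronglyGradedSubalgebra 𝒱 A₀ V₀) :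
    positivePart 𝒱 V₀ ≤ ⨆ h : {h : ℤ // 0 < h}, ⨆ α : {α : A // (α : At) ∈ A₀},
      𝒱.wt h ⊓ 𝒱.gr α := by
  refine iSup_le fun h => le_iSup_of_le h fun u hu => ?_
  have h1 : u ∈ ⨆ n : ℤ, ⨆ α : {α : A // (α : At) ∈ A₀}, 𝒱.wt n ⊓ 𝒱.gr α := by
    have := hu.1
    rw [hV₀.graded, iSup_comm] at this
    have hle : (⨆ n : ℤ, ⨆ α : {α : A // (α : At) ∈ A₀}, V₀ ⊓ (𝒱.wt n ⊓ 𝒱.gr α))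
        ≤ ⨆ n : ℤ, ⨆ α : {α : A // (α : At) ∈ A₀}, 𝒱.wt n ⊓ 𝒱.gr α :=
      iSup₂_mono fun n α => inf_le_right
    exact hle this
  exact mem_of_mem_iSup_of_iSupIndep
    (f := fun n : ℤ => ⨆ α : {α : A // (α : At) ∈ A₀}, 𝒱.wt n ⊓ 𝒱.gr α)
    (fun n => iSup_le fun α => inf_le_left) 𝒱.wt_indep hu.2 h1

theorem C₁_le (hV₀ : IsStronglyGradedSubalgebra 𝒱 A₀ V₀) (M : StronglyGradedGenModule 𝒱 W) :
    M.C₁ V₀ ≤ ⨆ q : ℂ, ⨆ γ : At, c₁Piece A₀ M γ q := by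
  refine Submodule.span_le.2 ?_
  rintro _ ⟨u, hu, w, rfl⟩
  have hu' := positivePart_le hV₀ hu
  have hw : w ∈ ⨆ β : At, ⨆ n : ℂ, M.wt n ⊓ M.gr β := by
    rw [← iSup_congr M.gr_compatible, M.gr_span]; trivial
  set S := ⨆ q : ℂ, ⨆ γ : At, c₁Piece A₀ M γ q
  -- By bilinearity it suffices to treat homogeneous `u` and `w`.
  suffices h : (⨆ h : {h : ℤ // 0 < h}, ⨆ α : {α : A // (α : At) ∈ A₀}, 𝒱.wt h ⊓ 𝒱.gr α)
      ≤ S.comap ((M.Y (-1)).flip w) from h hu'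
  refine iSup₂_le fun h α u hu => ?_
  suffices h : (⨆ β : At, ⨆ n : ℂ, M.wt n ⊓ M.gr β) ≤ S.comap (M.Y (-1) u) from h hw
  refine iSup₂_le fun β n w hw => ?_
  refine Submodule.mem_iSup_of_mem (n + (h : ℤ)) (Submodule.mem_iSup_of_mem (α + β)
    (Submodule.subset_span ⟨α, h, α.2, h.2, u, hu, w, ?_, rfl⟩))
  rwa [add_sub_cancel_right, add_sub_cancel_left]

/-- `C₁`-cofiniteness in terms of weights: all but finitely many weight spaces of `W^(β)` lie in
`C₁(W)`, and consist of sums of homogeneous elements `u_{-1}w`. -/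
theorem StronglyGradedGenModule.C₁Cofinite.exists_finset {M : StronglyGradedGenModule 𝒱 W}
    (hM : M.C₁Cofinite V₀) (hV₀ : IsStronglyGradedSubalgebra 𝒱 A₀ V₀) (β : At) :
    ∃ F : Finset ℂ, ∀ p ∉ F, M.wt p ⊓ M.gr β ≤ c₁Piece A₀ M β p := by
  classical
  obtain ⟨s, hs⟩ := (hM β).fg_top
  have hsurj := Submodule.mkQ_surjective ((M.C₁ V₀).submoduleOf (M.gr β))
  choose r hr using hsurj
  have hr' : ∀ x, ∃ t : Finset ℂ, (r x : W) ∈ ⨆ n ∈ t, M.wt n ⊓ M.gr β := fun x => by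
    have h : (r x : W) ∈ ⨆ n, M.wt n ⊓ M.gr β := (M.gr_compatible β).le (r x).2
    exact Submodule.mem_iSup_iff_exists_finset.1 h
  choose t ht using hr'
  refine ⟨s.biUnion t, fun p hp w hw => ?_⟩
  set T : Submodule ℂ (M.gr β) := Submodule.span ℂ (r '' s) with hT
  have htop : (M.C₁ V₀).submoduleOf (M.gr β) ⊔ T = ⊤ := by
    rw [← Submodule.comap_map_mkQ, hT, Submodule.map_span, ← Set.image_comp]
    have : (⇑((M.C₁ V₀).submoduleOf (M.gr β)).mkQ ∘ r) = id := funext hr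
    rw [this, Set.image_id, hs, Submodule.comap_top]
  have hTle : ∀ x ∈ T, (x : W) ∈ ⨆ n ∈ s.biUnion t, M.wt n ⊓ M.gr β := by
    suffices h : T ≤ (⨆ n ∈ s.biUnion t, M.wt n ⊓ M.gr β).comap (M.gr β).subtype from
      fun x hx => h hx
    refine Submodule.span_le.2 ?_
    rintro _ ⟨x, hx, rfl⟩
    exact (iSup₂_le fun n hn => le_iSup₂_of_le n (Finset.mem_biUnion.2 ⟨x, hx, hn⟩) le_rfl :
      (⨆ n ∈ t x, M.wt n ⊓ M.gr β) ≤ _) (ht x)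
  have hw' : (⟨w, hw.2⟩ : M.gr β) ∈ (M.C₁ V₀).submoduleOf (M.gr β) ⊔ T := by
    rw [htop]; trivial
  obtain ⟨c, hc, x, hx, hcx⟩ := Submodule.mem_sup.1 hw'
  have hwcx : w = (c : W) + x := by rw [← Submodule.coe_add, hcx]
  have h1 : w ∈ ⨆ γ : At, c₁Piece A₀ M γ p := by
    have := mem_of_mem_iSup_of_iSupIndep (i := p) (x := w) (g := M.wt)
      (f := fun q => if q = p then ⨆ γ : At, c₁Piece A₀ M γ p else M.wt q) ?_ M.wt_indep hw.1 ?_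
    · simpa using this
    · intro q
      by_cases hq : q = p
      · subst hq
        simpa using fun γ => (c₁Piece_le (A₀ := A₀) M γ q).trans inf_le_left
      · simp [hq]
    · rw [hwcx]
      refine Submodule.add_mem _ ?_ ?_
      · refine (iSup_mono fun q => ?_ : (⨆ q : ℂ, ⨆ γ : At, c₁Piece A₀ M γ q) ≤ _)
          (C₁_le hV₀ M (show (c : W) ∈ M.C₁ V₀ from hc))
        by_cases hq : q = p
        · rw [if_pos hq, hq]
        · rw [if_neg hq]
          exact iSup_le fun γ => (c₁Piece_le M γ q).trans inf_le_left
      · refine (iSup₂_le fun n hn => ?_ : (⨆ n ∈ s.biUnion t, M.wt n ⊓ M.gr β) ≤ _) (hTle x hx)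
        have hnp : n ≠ p := fun h => hp (h ▸ hn)
        refine le_iSup_of_le n ?_
        rw [if_neg hnp]
        exact inf_le_left
  exact mem_of_mem_iSup_of_iSupIndep (fun γ => (c₁Piece_le M γ p).trans inf_le_right)
    M.gr_indep hw.2 h1

end

/-! ### Vanishing fusion rules -/

section Fusion

variable {At : Type*} [AddCommGroup At] {A A₀ : AddSubgroup At}
  {V : Type*} [AddCommGroup V] [Module ℂ V] {𝒱 : StronglyGradedCVA A V}
  {W₁ W₂ W₃ : Type*}
  [AddCommGroup W₁] [Module ℂ W₁] [AddCommGroup W₂] [Module ℂ W₂] [AddCommGroup W₃] [Module ℂ W₃]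
  {M₁ : GradedAction 𝒱 W₁} {M₂ : GradedAction 𝒱 W₂} {M₃ : GradedAction 𝒱 W₃}
  {𝒴 : LogModes W₁ W₂ W₃}

/-- The restriction of a grading-compatible operator to homogeneous subspaces. -/
def restrictLogModes (h : IsGradedLogIntertwining M₁ M₂ M₃ 𝒴) (γ₁ γ₂ : At) :
    LogModes ↥(M₁.gr γ₁) ↥(M₂.gr γ₂) ↥(M₃.gr (γ₁ + γ₂)) := fun n k =>
  LinearMap.mk₂ ℂ
    (fun w₁ w₂ => ⟨𝒴 n k w₁ w₂, h.grading_compatible γ₁ γ₂ w₁ w₁.2 w₂ w₂.2 n k⟩)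
    (fun _ _ _ => by ext; simp)
    (fun _ _ _ => by ext; simp)
    (fun _ _ _ => by ext; simp)
    (fun _ _ _ => by ext; simp)

theorem coe_restrictLogModes (h : IsGradedLogIntertwining M₁ M₂ M₃ 𝒴) (γ₁ γ₂ : At) (n : ℂ) (k : ℕ)
    (w₁ : M₁.gr γ₁) (w₂ : M₂.gr γ₂) :
    (restrictLogModes h γ₁ γ₂ n k w₁ w₂ : W₃) = 𝒴 n k w₁ w₂ := rfl

theorem coe_component (M : GradedAction 𝒱 W₁) (γ : At) (n : ℤ) (u : 𝒱.gr 0) (w : M.gr γ) :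
    (M.component γ n u w : W₁) = M.Y n u w := rfl

theorem coe_finsum {E ι : Type*} [AddCommGroup E] [Module ℂ E] (S : Submodule ℂ E) (f : ι → S) :
    ((∑ᶠ i, f i : S) : E) = ∑ᶠ i, (f i : E) :=
  AddMonoidHom.map_finsum_of_injective S.subtype.toAddMonoidHom Subtype.coe_injective f

theorem isLogIntertwining_restrict (h : IsGradedLogIntertwining M₁ M₂ M₃ 𝒴) (γ₁ γ₂ : At) :
    IsLogIntertwining (⟨𝒱.ω, 𝒱.ω_mem_gr⟩ : ↥(𝒱.gr 0)) (M₁.component γ₁) (M₂.component γ₂)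
      (M₃.component (γ₁ + γ₂)) (restrictLogModes h γ₁ γ₂) where
  log_polynomial w₁ w₂ n := (h.log_polynomial w₁ w₂ n).subset fun k hk hc =>
    hk (Subtype.ext hc)
  lower_truncation w₁ w₂ n := (h.lower_truncation w₁ w₂ n).imp fun N hN m hm k =>
    Subtype.ext (hN m hm k)
  jacobi k u w₁ w₂ l m n := by
    refine Subtype.ext ?_
    simp only [Submodule.coe_sub, coe_finsum, AddSubgroupClass.coe_zsmul, coe_component,
      coe_restrictLogModes]
    exact h.jacobi k u w₁ w₂ l m n
  derivative w₁ w₂ n k := Subtype.ext (h.derivative w₁ w₂ n k)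

theorem eq_zero_of_rank_span_eq_zero {E : Type*} [AddCommGroup E] [Module ℂ E] {s : Set E}
    (h : Module.rank ℂ (Submodule.span ℂ s) = 0) {x : E} (hx : x ∈ s) : x = 0 :=
  congrArg Subtype.val ((rank_zero_iff.1 h).elim ⟨x, Submodule.subset_span hx⟩ 0)

theorem eq_zero_of_fusionRule_eq_zero (h : IsGradedLogIntertwining M₁ M₂ M₃ 𝒴) {γ₁ γ₂ : At}
    (h0 : fusionRule M₁ M₂ M₃ γ₁ γ₂ = 0) {w₁ : W₁} {w₂ : W₂} (hw₁ : w₁ ∈ M₁.gr γ₁)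
    (hw₂ : w₂ ∈ M₂.gr γ₂) (n : ℂ) (k : ℕ) : 𝒴 n k w₁ w₂ = 0 := by
  have h1 : restrictLogModes h γ₁ γ₂ = 0 := by
    unfold fusionRule at h0
    exact eq_zero_of_rank_span_eq_zero h0 (isLogIntertwining_restrict h γ₁ γ₂)
  have h2 : restrictLogModes h γ₁ γ₂ n k ⟨w₁, hw₁⟩ ⟨w₂, hw₂⟩ = 0 := by
    rw [h1]
    rfl
  exact congrArg Subtype.val h2

end Fusion

/-! ### Differential equations from a finitely generated module -/

theorem expand_smul_mem (N : Submodule expandRange SeriesSpace) {c : IterLaurent}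
    (hc : c ∈ expandRange) {x : SeriesSpace} (hx : x ∈ N) : c • x ∈ N :=
  N.smul_mem ⟨c, hc⟩ hx

/-- An `expandRange`-submodule, regarded as a complex subspace. -/
def complexSubmodule (N : Submodule expandRange SeriesSpace) : Submodule ℂ SeriesSpace where
  carrier := N
  add_mem' := N.add_mem
  zero_mem' := N.zero_mem
  smul_mem' a x hx := by
    have : a • x = lmonomial a 0 0 • x := by
      funext p q k l
      exact smul_eq_lmonomial_mul a _
    rw [this]
    exact expand_smul_mem N (lmonomial_mem a 0 0) hx

/-- Over a noetherian ring, every sequence in a finitely generated module satisfies a monic linear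
relation. -/
theorem exists_monic_relation {R E : Type*} [CommRing R] [IsNoetherianRing R] [AddCommGroup E]
    [Module R E] {N : Submodule R E} (hN : N.FG) (x : ℕ → E) (hx : ∀ n, x n ∈ N) :
    ∃ (m : ℕ) (a : ℕ → R), 1 ≤ m ∧ x m + ∑ k ∈ Finset.Icc 1 m, a k • x (m - k) = 0 := by
  have hN' : IsNoetherian R N := isNoetherian_of_fg_of_noetherian N hN
  let S : ℕ →o Submodule R N :=
    ⟨fun n => Submodule.span R ((fun i => (⟨x i, hx i⟩ : N)) '' Set.Iio n), fun a b hab =>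
      Submodule.span_mono (Set.image_mono (Set.Iio_subset_Iio hab))⟩
  obtain ⟨n, hn⟩ := monotone_stabilizes_iff_noetherian.2 hN' S
  have hmem : (⟨x (n + 1), hx _⟩ : N) ∈ S (n + 1) := by
    rw [← hn (n + 1) (by omega), hn (n + 2) (by omega)]
    exact Submodule.subset_span ⟨n + 1, Set.mem_Iio.2 (by omega), rfl⟩
  obtain ⟨c, hc⟩ : ∃ c : ℕ → R, ∑ i ∈ Finset.range (n + 1), c i • x i = x (n + 1) := by
    have h1 : (⟨x (n + 1), hx _⟩ : N) ∈ Submodule.span R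
        ((fun i => (⟨x i, hx i⟩ : N)) '' (Finset.range (n + 1) : Set ℕ)) := by
      rw [Finset.coe_range]; exact hmem
    obtain ⟨c, hcs, hc⟩ := (Finsupp.mem_span_image_iff_linearCombination R).1 h1
    rw [Finsupp.linearCombination_apply_of_mem_supported R hcs] at hc
    refine ⟨c, ?_⟩
    simpa using congrArg Subtype.val hc
  refine ⟨n + 1, fun k => -c (n + 1 - k), by omega, ?_⟩
  have : ∑ k ∈ Finset.Icc 1 (n + 1), (-c (n + 1 - k)) • x (n + 1 - k)
      = -∑ i ∈ Finset.range (n + 1), c i • x i := by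
    rw [← Finset.sum_neg_distrib]
    refine Finset.sum_bij' (fun k _ => n + 1 - k) (fun i _ => n + 1 - i) ?_ ?_ ?_ ?_ ?_
    all_goals intro k hk
    all_goals simp only [Finset.mem_Icc, Finset.mem_range] at hk ⊢
    any_goals omega
    rw [neg_smul]
  rw [this, hc, add_neg_cancel]

/-- `F` records the formal series `φ`. -/
def Represents (F : SeriesSpace) (φ : LogSeries) : Prop :=
  ∀ p q k l i j, lcoeff (F p q k l) i j = φ (p + i) (q + j) k l

theorem Represents.factor {F : SeriesSpace} {φ : LogSeries} (h : Represents F φ) (a : CoeffRing)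
    (p q : ℂ) (k l : ℕ) (m : ℤ × ℤ) :
    lcoeff (expandHom a) m.1 m.2 * lcoeff (F p q k l) (0 - m.1) (0 - m.2)
      = expandCoeff a m.1 m.2 * φ (p - m.1) (q - m.2) k l := by
  rw [h, zero_sub, zero_sub, Int.cast_neg, Int.cast_neg, ← sub_eq_add_neg, ← sub_eq_add_neg]
  rfl

theorem Represents.productExists {F : SeriesSpace} {φ : LogSeries} (h : Represents F φ)
    (a : CoeffRing) : ProductExists a φ := fun p q k l => by
  simpa only [h.factor a p q k l] using lcoeff_mul_support (expandHom a) (F p q k l) 0 0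

theorem Represents.expandMul {F : SeriesSpace} {φ : LogSeries} (h : Represents F φ)
    (a : CoeffRing) (p q : ℂ) (k l : ℕ) :
    lcoeff ((expandHom a • F) p q k l) 0 0 = VertexAlg.expandMul a φ p q k l := by
  rw [Pi.smul_apply, Pi.smul_apply, Pi.smul_apply, Pi.smul_apply, smul_eq_mul, lcoeff_mul]
  exact finsum_congr fun m => h.factor a p q k l m

theorem exists_satisfiesODE {N : Submodule expandRange SeriesSpace} (hN : N.FG)
    {D : LogSeries → LogSeries} {φ : LogSeries} {x : ℕ → SeriesSpace} (hx : ∀ n, x n ∈ N)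
    (hxφ : ∀ n, Represents (x n) (D^[n] φ)) :
    ∃ (m : ℕ) (a : ℕ → CoeffRing), 1 ≤ m ∧ SatisfiesODE D m a φ := by
  obtain ⟨m, c, hm, hc⟩ := exists_monic_relation hN x hx
  choose a ha using fun k => (c k).2
  refine ⟨m, a, hm, fun k _ => (hxφ (m - k)).productExists (a k), ?_⟩
  funext p q k l
  have h1 := congrArg (fun F : SeriesSpace => lcoeff (F p q k l) 0 0) hc
  have h2 : ∀ n, c n • x (m - n) = expandHom (a n) • x (m - n) := fun n => by
    rw [ha]; rfl
  simp only [h2, Pi.add_apply, Finset.sum_apply, lcoeff_add, lcoeff_sum,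
    (hxφ _).expandMul (a _) p q k l] at h1
  rw [hxφ m, Int.cast_zero, add_zero, add_zero] at h1
  simpa [Finset.sum_apply] using h1

/-! ### Reduction of the weights -/

section Reduction

variable {At : Type*} [AddCommGroup At] {A A₀ : AddSubgroup At}
  {V : Type*} [AddCommGroup V] [Module ℂ V] {𝒱 : StronglyGradedCVA A V}
  {W₀ W₁ W₂ W₃ W₄ : Type*} [AddCommGroup W₀] [Module ℂ W₀]
  [AddCommGroup W₁] [Module ℂ W₁] [AddCommGroup W₂] [Module ℂ W₂] [AddCommGroup W₃] [Module ℂ W₃]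
  [AddCommGroup W₄] [Module ℂ W₄]
  {M₀ : StronglyGradedGenModule 𝒱 W₀} {M₁ : StronglyGradedGenModule 𝒱 W₁}
  {M₂ : StronglyGradedGenModule 𝒱 W₂} {M₃ : StronglyGradedGenModule 𝒱 W₃}
  {M₄ : StronglyGradedGenModule 𝒱 W₄}
  {𝒴₁ : LogModes W₁ W₄ ↥(restrictedDual M₀)} {𝒴₂ : LogModes W₂ W₃ W₄}
  (h₁ : IsLogIntertwining 𝒱.ω M₁.Y M₄.Y (contragredient M₀).Y 𝒴₁)
  (h₂ : IsLogIntertwining 𝒱.ω M₂.Y M₃.Y M₄.Y 𝒴₂)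

/-- The matrix elements with bihomogeneous arguments of total weight less than `s` (in the real
part), of degrees in the cosets of `β₁, β₂, β₃` modulo `A₀`, all lie in `N`. -/
def WeightLTMem (A₀ : AddSubgroup At) (β₁ β₂ β₃ : At) (N : Submodule expandRange SeriesSpace)
    (s : ℝ) : Prop :=
  ∀ γ₀ γ₁ γ₂ γ₃ : At, γ₁ - β₁ ∈ A₀ → γ₂ - β₂ ∈ A₀ → γ₃ - β₃ ∈ A₀ →
    ∀ p₀ p₁ p₂ p₃ : ℂ, (p₀ + p₁ + p₂ + p₃).re < s →
      ∀ w₀ ∈ M₀.wt p₀ ⊓ M₀.gr γ₀, ∀ w₁ ∈ M₁.wt p₁ ⊓ M₁.gr γ₁, ∀ w₂ ∈ M₂.wt p₂ ⊓ M₂.gr γ₂,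
        ∀ w₃ ∈ M₃.wt p₃ ⊓ M₃.gr γ₃, matrixMap h₁ h₂ w₀ w₁ w₂ w₃ ∈ N

theorem mode_mem {W : Type*} [AddCommGroup W] [Module ℂ W] (M : StronglyGradedGenModule 𝒱 W)
    {h n : ℤ} {p : ℂ} {α : A} {γ : At} {u : V} {w : W} (hu : u ∈ 𝒱.wt h ⊓ 𝒱.gr α)
    (hw : w ∈ M.wt p ⊓ M.gr γ) :
    M.Y n u w ∈ M.wt (p + h - n - 1) ⊓ M.gr (α + γ) :=
  ⟨mode_mem_wt M hu.1 hw.1, M.gr_Y α γ n u hu.2 w hw.2⟩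

theorem coset_add {α β γ : At} (hα : α ∈ A₀) (hγ : γ - β ∈ A₀) : α + γ - β ∈ A₀ := by
  rw [add_sub_assoc]; exact A₀.add_mem hα hγ

theorem coset_sub {α β γ : At} (hα : α ∈ A₀) (hγ : γ - β ∈ A₀) : γ - α - β ∈ A₀ := by
  rw [sub_right_comm]; exact A₀.sub_mem hγ hα

variable {h₁ h₂} {β₁ β₂ β₃ : At} {N : Submodule expandRange SeriesSpace} {s : ℝ}
  {γ₀ γ₁ γ₂ γ₃ : At} {p₀ p₁ p₂ p₃ : ℂ} {w₀ : W₀} {w₁ : W₁} {w₂ : W₂} {w₃ : W₃}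

/-- If `w₁` is a sum of elements `u_{-1}w`, then its matrix elements of total weight less than
`s + 1` reduce to those of total weight less than `s`. -/
theorem WeightLTMem.step₁ (H : WeightLTMem h₁ h₂ A₀ β₁ β₂ β₃ N s)
    (hγ₁ : γ₁ - β₁ ∈ A₀) (hγ₂ : γ₂ - β₂ ∈ A₀) (hγ₃ : γ₃ - β₃ ∈ A₀)
    (hs : (p₀ + p₁ + p₂ + p₃).re < s + 1) (hw₀ : w₀ ∈ M₀.wt p₀ ⊓ M₀.gr γ₀)
    (hw₁ : w₁ ∈ c₁Piece A₀ M₁ γ₁ p₁) (hw₂ : w₂ ∈ M₂.wt p₂ ⊓ M₂.gr γ₂)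
    (hw₃ : w₃ ∈ M₃.wt p₃ ⊓ M₃.gr γ₃) : matrixMap h₁ h₂ w₀ w₁ w₂ w₃ ∈ N := by
  suffices h : c₁Piece A₀ M₁ γ₁ p₁ ≤ (complexSubmodule N).comap
      (((matrixMap h₁ h₂ w₀).flip w₂).flip w₃) from h hw₁
  refine Submodule.span_le.2 ?_
  rintro _ ⟨α, h, hα, hh, u, hu, w, hw, rfl⟩
  obtain ⟨B₀, hB₀⟩ := oppositeMode_truncation M₀ hu.1 w₀
  obtain ⟨B₂, hB₂⟩ := M₂.lower_truncation.exists_nat' u w₂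
  obtain ⟨B₃, hB₃⟩ := M₃.lower_truncation.exists_nat' u w₃
  have hh' : (1 : ℝ) ≤ h := by exact_mod_cast hh
  have key := matrixMap_mode₁ h₁ h₂ (u := u) (w₀ := w₀) (w₂ := w₂) (w₃ := w₃)
    (N := B₀ + B₂ + B₃) (fun i hi => hB₀ i (by omega)) (fun i hi => hB₂ i (by omega))
    (fun i hi => hB₃ i (by omega)) w
  change matrixMap h₁ h₂ w₀ (M₁.Y (-1) u w) w₂ w₃ ∈ N
  rw [key]
  refine N.add_mem (N.add_mem ?_ ?_) ?_ <;> refine N.sum_mem fun i _ => ?_ <;>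
    have hi : (0 : ℝ) ≤ i := Nat.cast_nonneg i
  · refine expand_smul_mem N (lmonomial_mem _ _ _) (H _ _ _ _ (coset_sub hα hγ₁) hγ₂ hγ₃ _ _ _ _ ?_
      _ (oppositeMode_mem M₀ hu hw₀) _ hw _ hw₂ _ hw₃)
    simp only [Complex.add_re, Complex.sub_re, Complex.intCast_re, Complex.one_re] at hs ⊢
    push_cast
    linarith
  · refine expand_smul_mem N (lmonomial_mem _ _ _) (H _ _ _ _ (coset_sub hα hγ₁) hγ₂
      (coset_add hα hγ₃) _ _ _ _ ?_ _ hw₀ _ hw _ hw₂ _ (mode_mem M₃ hu hw₃))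
    simp only [Complex.add_re, Complex.sub_re, Complex.intCast_re, Complex.one_re] at hs ⊢
    push_cast
    linarith
  · refine expand_smul_mem N (diffInv_mem _) (H _ _ _ _ (coset_sub hα hγ₁) (coset_add hα hγ₂)
      hγ₃ _ _ _ _ ?_ _ hw₀ _ hw _ (mode_mem M₂ hu hw₂) _ hw₃)
    simp only [Complex.add_re, Complex.sub_re, Complex.intCast_re, Complex.one_re] at hs ⊢
    push_cast
    linarith

/-- If `w₂` is a sum of elements `u_{-1}w`, then its matrix elements of total weight less than
`s + 1` reduce to those of total weight less than `s`. -/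
theorem WeightLTMem.step₂ (H : WeightLTMem h₁ h₂ A₀ β₁ β₂ β₃ N s)
    (hγ₁ : γ₁ - β₁ ∈ A₀) (hγ₂ : γ₂ - β₂ ∈ A₀) (hγ₃ : γ₃ - β₃ ∈ A₀)
    (hs : (p₀ + p₁ + p₂ + p₃).re < s + 1) (hw₀ : w₀ ∈ M₀.wt p₀ ⊓ M₀.gr γ₀)
    (hw₁ : w₁ ∈ M₁.wt p₁ ⊓ M₁.gr γ₁) (hw₂ : w₂ ∈ c₁Piece A₀ M₂ γ₂ p₂)
    (hw₃ : w₃ ∈ M₃.wt p₃ ⊓ M₃.gr γ₃) : matrixMap h₁ h₂ w₀ w₁ w₂ w₃ ∈ N := by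
  suffices h : c₁Piece A₀ M₂ γ₂ p₂ ≤ (complexSubmodule N).comap
      ((matrixMap h₁ h₂ w₀ w₁).flip w₃) from h hw₂
  refine Submodule.span_le.2 ?_
  rintro _ ⟨α, h, hα, hh, u, hu, w, hw, rfl⟩
  obtain ⟨B₀, hB₀⟩ := oppositeMode_truncation M₀ hu.1 w₀
  obtain ⟨B₁, hB₁⟩ := M₁.lower_truncation.exists_nat' u w₁
  obtain ⟨B₃, hB₃⟩ := M₃.lower_truncation.exists_nat' u w₃
  have hh' : (1 : ℝ) ≤ h := by exact_mod_cast hh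
  have key := matrixMap_mode₂ h₁ h₂ (u := u) (w₀ := w₀) (w₁ := w₁) (w₃ := w₃)
    (N := B₀ + B₁ + B₃) (fun i hi => hB₀ i (by omega)) (fun i hi => hB₁ i (by omega))
    (fun i hi => hB₃ i (by omega)) w
  change matrixMap h₁ h₂ w₀ w₁ (M₂.Y (-1) u w) w₃ ∈ N
  rw [key]
  refine N.add_mem (N.sub_mem ?_ ?_) ?_ <;> refine N.sum_mem fun i _ => ?_ <;>
    have hi : (0 : ℝ) ≤ i := Nat.cast_nonneg i
  · refine expand_smul_mem N (lmonomial_mem _ _ _) (H _ _ _ _ hγ₁ (coset_sub hα hγ₂) hγ₃ _ _ _ _ ?_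
      _ (oppositeMode_mem M₀ hu hw₀) _ hw₁ _ hw _ hw₃)
    simp only [Complex.add_re, Complex.sub_re, Complex.intCast_re, Complex.one_re] at hs ⊢
    push_cast
    linarith
  · refine expand_smul_mem N (lmonomial_mem _ _ _) (expand_smul_mem N (diffInv_mem _)
      (H _ _ _ _ (coset_add hα hγ₁) (coset_sub hα hγ₂) hγ₃ _ _ _ _ ?_
        _ hw₀ _ (mode_mem M₁ hu hw₁) _ hw _ hw₃))
    simp only [Complex.add_re, Complex.sub_re, Complex.intCast_re, Complex.one_re] at hs ⊢
    push_cast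
    linarith
  · refine expand_smul_mem N (lmonomial_mem _ _ _) (H _ _ _ _ hγ₁ (coset_sub hα hγ₂)
      (coset_add hα hγ₃) _ _ _ _ ?_ _ hw₀ _ hw₁ _ hw _ (mode_mem M₃ hu hw₃))
    simp only [Complex.add_re, Complex.sub_re, Complex.intCast_re, Complex.one_re] at hs ⊢
    push_cast
    linarith

/-- If `w₃` is a sum of elements `u_{-1}w`, then its matrix elements of total weight less than
`s + 1` reduce to those of total weight less than `s`. -/
theorem WeightLTMem.step₃ (H : WeightLTMem h₁ h₂ A₀ β₁ β₂ β₃ N s)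
    (hγ₁ : γ₁ - β₁ ∈ A₀) (hγ₂ : γ₂ - β₂ ∈ A₀) (hγ₃ : γ₃ - β₃ ∈ A₀)
    (hs : (p₀ + p₁ + p₂ + p₃).re < s + 1) (hw₀ : w₀ ∈ M₀.wt p₀ ⊓ M₀.gr γ₀)
    (hw₁ : w₁ ∈ M₁.wt p₁ ⊓ M₁.gr γ₁) (hw₂ : w₂ ∈ M₂.wt p₂ ⊓ M₂.gr γ₂)
    (hw₃ : w₃ ∈ c₁Piece A₀ M₃ γ₃ p₃) : matrixMap h₁ h₂ w₀ w₁ w₂ w₃ ∈ N := by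
  suffices h : c₁Piece A₀ M₃ γ₃ p₃ ≤ (complexSubmodule N).comap
      (matrixMap h₁ h₂ w₀ w₁ w₂) from h hw₃
  refine Submodule.span_le.2 ?_
  rintro _ ⟨α, h, hα, hh, u, hu, w, hw, rfl⟩
  obtain ⟨B₁, hB₁⟩ := M₁.lower_truncation.exists_nat' u w₁
  obtain ⟨B₂, hB₂⟩ := M₂.lower_truncation.exists_nat' u w₂
  have hh' : (1 : ℝ) ≤ h := by exact_mod_cast hh
  have key := matrixMap_mode₃ h₁ h₂ (u := u) (w₁ := w₁) (w₂ := w₂)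
    (N := B₁ + B₂) (fun i hi => hB₁ i (by omega)) (fun i hi => hB₂ i (by omega)) w₀ w (-1)
  rw [add_assoc] at key
  change matrixMap h₁ h₂ w₀ w₁ w₂ (M₃.Y (-1) u w) ∈ N
  rw [eq_sub_of_add_eq key.symm]
  refine N.sub_mem ?_ (N.add_mem (N.sum_mem fun i _ => ?_) (N.sum_mem fun i _ => ?_))
  · refine H _ _ _ _ hγ₁ hγ₂ (coset_sub hα hγ₃) _ _ _ _ ?_
      _ (oppositeMode_mem M₀ hu hw₀) _ hw₁ _ hw₂ _ hw
    simp only [Complex.add_re, Complex.sub_re, Complex.intCast_re, Complex.one_re] at hs ⊢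
    push_cast
    linarith
  · have hi : (0 : ℝ) ≤ i := Nat.cast_nonneg i
    refine expand_smul_mem N (lmonomial_mem _ _ _) (H _ _ _ _ (coset_add hα hγ₁) hγ₂
      (coset_sub hα hγ₃) _ _ _ _ ?_ _ hw₀ _ (mode_mem M₁ hu hw₁) _ hw₂ _ hw)
    simp only [Complex.add_re, Complex.sub_re, Complex.intCast_re, Complex.one_re] at hs ⊢
    push_cast
    linarith
  · have hi : (0 : ℝ) ≤ i := Nat.cast_nonneg i
    refine expand_smul_mem N (lmonomial_mem _ _ _) (H _ _ _ _ hγ₁ (coset_add hα hγ₂)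
      (coset_sub hα hγ₃) _ _ _ _ ?_ _ hw₀ _ hw₁ _ (mode_mem M₂ hu hw₂) _ hw)
    simp only [Complex.add_re, Complex.sub_re, Complex.intCast_re, Complex.one_re] at hs ⊢
    push_cast
    linarith

/-- If `w₀` is a sum of elements `u_{-1}w`, then its matrix elements of total weight less than
`s + 1` reduce to those of total weight less than `s`. -/
theorem WeightLTMem.step₀ (H : WeightLTMem h₁ h₂ A₀ β₁ β₂ β₃ N s)
    (hγ₁ : γ₁ - β₁ ∈ A₀) (hγ₂ : γ₂ - β₂ ∈ A₀) (hγ₃ : γ₃ - β₃ ∈ A₀)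
    (hs : (p₀ + p₁ + p₂ + p₃).re < s + 1) (hw₀ : w₀ ∈ c₁Piece A₀ M₀ γ₀ p₀)
    (hw₁ : w₁ ∈ M₁.wt p₁ ⊓ M₁.gr γ₁) (hw₂ : w₂ ∈ M₂.wt p₂ ⊓ M₂.gr γ₂)
    (hw₃ : w₃ ∈ M₃.wt p₃ ⊓ M₃.gr γ₃) : matrixMap h₁ h₂ w₀ w₁ w₂ w₃ ∈ N := by
  suffices h : c₁Piece A₀ M₀ γ₀ p₀ ≤ (complexSubmodule N).comap
      ((((matrixMap h₁ h₂).flip w₁).flip w₂).flip w₃) from h hw₀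
  refine Submodule.span_le.2 ?_
  rintro _ ⟨α, h, hα, hh, u, hu, w, hw, rfl⟩
  have hh' : (1 : ℝ) ≤ h := by exact_mod_cast hh
  obtain ⟨J, hJ⟩ := L_one_nilpotent (𝒱 := 𝒱) u
  -- The weight `h - j` of `L(1)^j u` may be negative. The total weight still drops, since only
  -- nonnegative modes act on `w₁` and `w₂`, and the mode `2h - 1 - j` shifts weights by `-h`.
  rw [mode_eq_sum_oppositeMode M₀ hu hJ (-1), LinearMap.sum_apply]
  refine Submodule.sum_mem _ fun j _ => ?_
  rw [LinearMap.smul_apply]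
  refine Submodule.smul_mem _ _ ?_
  set v := (vir 𝒱.Y 𝒱.ω 1 ^ j) u with hv_def
  have hv : v ∈ 𝒱.wt (h - j) ⊓ 𝒱.gr α := L_one_pow_mem hu j
  obtain ⟨B₁, hB₁⟩ := M₁.lower_truncation.exists_nat' v w₁
  obtain ⟨B₂, hB₂⟩ := M₂.lower_truncation.exists_nat' v w₂
  have hj : (0 : ℝ) ≤ j := Nat.cast_nonneg j
  change matrixMap h₁ h₂ (oppositeMode M₀ (2 * h - -1 - 2 - j) v w) w₁ w₂ w₃ ∈ N
  rw [matrixMap_mode₃ h₁ h₂ (u := v) (w₁ := w₁) (w₂ := w₂)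
    (N := B₁ + B₂) (fun i hi => hB₁ i (by omega)) (fun i hi => hB₂ i (by omega)) w w₃]
  refine N.add_mem (N.add_mem ?_ (N.sum_mem fun i _ => ?_)) (N.sum_mem fun i _ => ?_)
  · refine H _ _ _ _ hγ₁ hγ₂ (coset_add hα hγ₃) _ _ _ _ ?_ _ hw _ hw₁ _ hw₂ _ (mode_mem M₃ hv hw₃)
    simp only [Complex.add_re, Complex.sub_re, Complex.intCast_re, Complex.one_re] at hs ⊢
    push_cast
    linarith
  · have hi : (0 : ℝ) ≤ i := Nat.cast_nonneg i
    refine expand_smul_mem N (lmonomial_mem _ _ _) (H _ _ _ _ (coset_add hα hγ₁) hγ₂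
      hγ₃ _ _ _ _ ?_ _ hw _ (mode_mem M₁ hv hw₁) _ hw₂ _ hw₃)
    simp only [Complex.add_re, Complex.sub_re, Complex.intCast_re, Complex.one_re] at hs ⊢
    push_cast
    linarith
  · have hi : (0 : ℝ) ≤ i := Nat.cast_nonneg i
    refine expand_smul_mem N (lmonomial_mem _ _ _) (H _ _ _ _ hγ₁ (coset_add hα hγ₂)
      hγ₃ _ _ _ _ ?_ _ hw _ hw₁ _ (mode_mem M₂ hv hw₂) _ hw₃)
    simp only [Complex.add_re, Complex.sub_re, Complex.intCast_re, Complex.one_re] at hs ⊢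
    push_cast
    linarith

end Reduction

/-! ### The finitely generated module of matrix elements -/

section FiniteGeneration

variable {At : Type*} [AddCommGroup At] {A A₀ : AddSubgroup At}
  {V : Type*} [AddCommGroup V] [Module ℂ V] {𝒱 : StronglyGradedCVA A V} {V₀ : Submodule ℂ V}

theorem apply_eq_zero_of_mem_dualGr {W : Type*} [AddCommGroup W] [Module ℂ W]
    (M : StronglyGradedGenModule 𝒱 W) {β γ : At} {f : Module.Dual ℂ W} (hf : f ∈ dualGr M β)
    {w : W} (hw : w ∈ M.gr γ) (hne : γ ≠ -β) : f w = 0 := by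
  rw [M.gr_compatible γ] at hw
  suffices h : dualGr M β ≤ LinearMap.ker (Module.Dual.eval ℂ W w) from h hf
  refine iSup_le fun n g hg => ?_
  suffices h : (⨆ p, M.wt p ⊓ M.gr γ) ≤ LinearMap.ker g from h hw
  exact iSup_le fun p x hx => hg γ p (fun h => hne (congrArg Prod.fst h)) x hx

theorem fg_iSup_pieces {W ι : Type*} [AddCommGroup W] [Module ℂ W]
    (M : StronglyGradedGenModule 𝒱 W) (s : Finset ι) (π : ι → At) (F : At → Finset ℂ) :
    (⨆ g ∈ s, ⨆ p ∈ F (π g), M.wt p ⊓ M.gr (π g)).FG :=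
  Submodule.fg_biSup _ _ fun g _ => Submodule.fg_biSup _ _ fun p _ =>
    Module.Finite.iff_fg.1 (M.gr_finite (π g) p)

variable {W₀ W₁ W₂ W₃ W₄ : Type*} [AddCommGroup W₀] [Module ℂ W₀]
  [AddCommGroup W₁] [Module ℂ W₁] [AddCommGroup W₂] [Module ℂ W₂] [AddCommGroup W₃] [Module ℂ W₃]
  [AddCommGroup W₄] [Module ℂ W₄]

theorem exists_fg_of_multilinear
    (Φ : W₀ →ₗ[ℂ] W₁ →ₗ[ℂ] W₂ →ₗ[ℂ] W₃ →ₗ[ℂ] SeriesSpace) {X₀ : Submodule ℂ W₀}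
    {X₁ : Submodule ℂ W₁} {X₂ : Submodule ℂ W₂} {X₃ : Submodule ℂ W₃} (h₀ : X₀.FG) (h₁ : X₁.FG)
    (h₂ : X₂.FG) (h₃ : X₃.FG) :
    ∃ N : Submodule expandRange SeriesSpace, N.FG ∧
      ∀ w₀ ∈ X₀, ∀ w₁ ∈ X₁, ∀ w₂ ∈ X₂, ∀ w₃ ∈ X₃, Φ w₀ w₁ w₂ w₃ ∈ N := by
  obtain ⟨s, hs⟩ := ((((h₀.map₂ Φ h₁).map₂ LinearMap.id h₂).map₂ LinearMap.id h₃) : Submodule.FG _)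
  refine ⟨Submodule.span expandRange s, ⟨s, rfl⟩, fun w₀ hw₀ w₁ hw₁ w₂ hw₂ w₃ hw₃ => ?_⟩
  have hle : Submodule.span ℂ (s : Set SeriesSpace)
      ≤ complexSubmodule (Submodule.span expandRange s) :=
    Submodule.span_le.2 fun x hx => Submodule.subset_span hx
  refine hle ?_
  rw [hs]
  exact Submodule.apply_mem_map₂ LinearMap.id (Submodule.apply_mem_map₂ LinearMap.id
    (Submodule.apply_mem_map₂ Φ hw₀ hw₁) hw₂) hw₃

variable {M₀ : StronglyGradedGenModule 𝒱 W₀} {M₁ : StronglyGradedGenModule 𝒱 W₁}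
  {M₂ : StronglyGradedGenModule 𝒱 W₂} {M₃ : StronglyGradedGenModule 𝒱 W₃}
  {M₄ : StronglyGradedGenModule 𝒱 W₄}
  {𝒴₁ : LogModes W₁ W₄ ↥(restrictedDual M₀)} {𝒴₂ : LogModes W₂ W₃ W₄}

/-- A nonzero matrix element of homogeneous elements has total degree zero, and both fusion rules
involved are nonzero. -/
theorem degrees_of_matrixMap_ne_zero
    (h𝒴₁ : IsGradedLogIntertwining M₁.toGradedAction M₄.toGradedAction (contragredient M₀) 𝒴₁)
    (h𝒴₂ : IsGradedLogIntertwining M₂.toGradedAction M₃.toGradedAction M₄.toGradedAction 𝒴₂)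
    {γ₀ γ₁ γ₂ γ₃ : At} {w₀ : W₀} {w₁ : W₁} {w₂ : W₂} {w₃ : W₃} (hw₀ : w₀ ∈ M₀.gr γ₀)
    (hw₁ : w₁ ∈ M₁.gr γ₁) (hw₂ : w₂ ∈ M₂.gr γ₂) (hw₃ : w₃ ∈ M₃.gr γ₃)
    (hne : matrixMap h𝒴₁.toIsLogIntertwining h𝒴₂.toIsLogIntertwining w₀ w₁ w₂ w₃ ≠ 0) :
    γ₀ = -(γ₁ + (γ₂ + γ₃)) ∧
      fusionRule M₁.toGradedAction M₄.toGradedAction (contragredient M₀) γ₁ (γ₂ + γ₃) ≠ 0 ∧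
      fusionRule M₂.toGradedAction M₃.toGradedAction M₄.toGradedAction γ₂ γ₃ ≠ 0 := by
  have h4 := fun n k => h𝒴₂.grading_compatible γ₂ γ₃ w₂ hw₂ w₃ hw₃ n k
  have hz : (∀ p q k l, matrixElement M₀ 𝒴₁ 𝒴₂ w₀ w₁ w₂ w₃ p q k l = 0) → False := fun h =>
    hne (SeriesSpace.ext fun p q k l i j => (lcoeff_matrixMap _ _ _ _ _ _ _ _ _ _ _ _).trans
      (h _ _ _ _))
  refine ⟨?_, fun h0 => hz fun p q k l => ?_, fun h0 => hz fun p q k l => ?_⟩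
  · by_contra hγ
    refine hz fun p q k l => apply_eq_zero_of_mem_dualGr M₀ ?_ hw₀ hγ
    exact h𝒴₁.grading_compatible γ₁ (γ₂ + γ₃) w₁ hw₁ _ (h4 _ _) _ _
  · rw [matrixElement, eq_zero_of_fusionRule_eq_zero h𝒴₁ h0 hw₁ (h4 _ _)]
    rfl
  · rw [matrixElement, eq_zero_of_fusionRule_eq_zero h𝒴₂ h0 hw₂ hw₃, map_zero]
    rfl

/-- The matrix elements with arguments in fixed homogeneous subspaces lie in a finitely generated
module over the coefficient ring: by induction on the total weight, all of them are combinations of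
those with arguments in finitely many of the bihomogeneous subspaces. -/
theorem exists_fg_matrixMap_mem (hV₀ : IsStronglyGradedSubalgebra 𝒱 A₀ V₀)
    (hB₀ : M₀.LowerBounded) (hB₁ : M₁.LowerBounded) (hB₂ : M₂.LowerBounded)
    (hB₃ : M₃.LowerBounded) (hC₀ : M₀.C₁Cofinite V₀) (hC₁ : M₁.C₁Cofinite V₀)
    (hC₂ : M₂.C₁Cofinite V₀) (hC₃ : M₃.C₁Cofinite V₀)
    (hF₁ : FiniteFusion A₀ M₁.toGradedAction M₄.toGradedAction (contragredient M₀))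
    (hF₂ : FiniteFusion A₀ M₂.toGradedAction M₃.toGradedAction M₄.toGradedAction)
    (h𝒴₁ : IsGradedLogIntertwining M₁.toGradedAction M₄.toGradedAction (contragredient M₀) 𝒴₁)
    (h𝒴₂ : IsGradedLogIntertwining M₂.toGradedAction M₃.toGradedAction M₄.toGradedAction 𝒴₂)
    (β₀ β₁ β₂ β₃ : At) :
    ∃ N : Submodule expandRange SeriesSpace, N.FG ∧
      ∀ w₀ ∈ M₀.gr β₀, ∀ w₁ ∈ M₁.gr β₁, ∀ w₂ ∈ M₂.gr β₂, ∀ w₃ ∈ M₃.gr β₃,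
        matrixMap h𝒴₁.toIsLogIntertwining h𝒴₂.toIsLogIntertwining w₀ w₁ w₂ w₃ ∈ N := by
  set h₁ := h𝒴₁.toIsLogIntertwining
  set h₂ := h𝒴₂.toIsLogIntertwining
  -- The degrees `(γ₁, γ₂, γ₃)` in the given cosets at which both fusion rules are nonzero.
  let G : Set (At × At × At) := {g | g.1 - β₁ ∈ A₀ ∧ g.2.1 - β₂ ∈ A₀ ∧ g.2.2 - β₃ ∈ A₀ ∧
    fusionRule M₁.toGradedAction M₄.toGradedAction (contragredient M₀) g.1 (g.2.1 + g.2.2) ≠ 0 ∧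
    fusionRule M₂.toGradedAction M₃.toGradedAction M₄.toGradedAction g.2.1 g.2.2 ≠ 0}
  have hG : G.Finite := by
    refine (((hF₁ β₁ (β₂ + β₃)).image Prod.fst).prod (hF₂ β₂ β₃)).subset ?_
    rintro ⟨a, b, c⟩ ⟨ha, hb, hc, hf₁, hf₂⟩
    refine ⟨⟨(a, b + c), ⟨ha, ?_, hf₁⟩, rfl⟩, hb, hc, hf₂⟩
    change b + c - (β₂ + β₃) ∈ A₀
    rw [add_sub_add_comm]
    exact A₀.add_mem hb hc
  choose F₀ hF₀ using hC₀.exists_finset hV₀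
  choose F₁ hF₁ using hC₁.exists_finset hV₀
  choose F₂ hF₂ using hC₂.exists_finset hV₀
  choose F₃ hF₃ using hC₃.exists_finset hV₀
  choose b₀ hb₀ using hB₀
  choose b₁ hb₁ using hB₁
  choose b₂ hb₂ using hB₂
  choose b₃ hb₃ using hB₃
  obtain ⟨N, hN, hNmem⟩ := exists_fg_of_multilinear (matrixMap h₁ h₂)
    (fg_iSup_pieces M₀ hG.toFinset (fun g => -(g.1 + (g.2.1 + g.2.2))) F₀)
    (fg_iSup_pieces M₁ hG.toFinset (fun g => g.1) F₁)
    (fg_iSup_pieces M₂ hG.toFinset (fun g => g.2.1) F₂)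
    (fg_iSup_pieces M₃ hG.toFinset (fun g => g.2.2) F₃)
  obtain ⟨r, hr⟩ : ∃ r : ℝ, ∀ g ∈ G,
      r ≤ b₀ (-(g.1 + (g.2.1 + g.2.2))) + b₁ g.1 + b₂ g.2.1 + b₃ g.2.2 := by
    obtain ⟨r, hr⟩ := (hG.image fun g : At × At × At =>
      b₀ (-(g.1 + (g.2.1 + g.2.2))) + b₁ g.1 + b₂ g.2.1 + b₃ g.2.2).bddBelow
    exact ⟨r, fun g hg => hr ⟨g, hg, rfl⟩⟩
  have hlow : WeightLTMem h₁ h₂ A₀ β₁ β₂ β₃ N r := by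
    intro γ₀ γ₁ γ₂ γ₃ hγ₁ hγ₂ hγ₃ p₀ p₁ p₂ p₃ hp w₀ hw₀ w₁ hw₁ w₂ hw₂ w₃ hw₃
    by_cases hne : matrixMap h₁ h₂ w₀ w₁ w₂ w₃ = 0
    · rw [hne]; exact N.zero_mem
    obtain ⟨rfl, hf₁, hf₂⟩ := degrees_of_matrixMap_ne_zero h𝒴₁ h𝒴₂ hw₀.2 hw₁.2 hw₂.2 hw₃.2 hne
    have hr' := hr (γ₁, γ₂, γ₃) ⟨hγ₁, hγ₂, hγ₃, hf₁, hf₂⟩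
    simp only [Complex.add_re] at hp hr'
    have q₀ : b₀ (-(γ₁ + (γ₂ + γ₃))) ≤ p₀.re := by
      by_contra hc
      rw [hb₀ _ _ (not_le.1 hc), Submodule.mem_bot] at hw₀
      exact hne (by simp [hw₀])
    have q₁ : b₁ γ₁ ≤ p₁.re := by
      by_contra hc
      rw [hb₁ _ _ (not_le.1 hc), Submodule.mem_bot] at hw₁
      exact hne (by simp [hw₁])
    have q₂ : b₂ γ₂ ≤ p₂.re := by
      by_contra hc
      rw [hb₂ _ _ (not_le.1 hc), Submodule.mem_bot] at hw₂
      exact hne (by simp [hw₂])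
    have q₃ : b₃ γ₃ ≤ p₃.re := by
      by_contra hc
      rw [hb₃ _ _ (not_le.1 hc), Submodule.mem_bot] at hw₃
      exact hne (by simp [hw₃])
    linarith
  have hall : ∀ n : ℕ, WeightLTMem h₁ h₂ A₀ β₁ β₂ β₃ N (r + n) := by
    intro n
    induction n with
    | zero => simpa using hlow
    | succ n ih =>
      intro γ₀ γ₁ γ₂ γ₃ hγ₁ hγ₂ hγ₃ p₀ p₁ p₂ p₃ hp w₀ hw₀ w₁ hw₁ w₂ hw₂ w₃ hw₃
      rw [Nat.cast_add, Nat.cast_one, ← add_assoc] at hp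
      by_cases hne : matrixMap h₁ h₂ w₀ w₁ w₂ w₃ = 0
      · rw [hne]; exact N.zero_mem
      obtain ⟨rfl, hf₁, hf₂⟩ := degrees_of_matrixMap_ne_zero h𝒴₁ h𝒴₂ hw₀.2 hw₁.2 hw₂.2 hw₃.2 hne
      have hg : (γ₁, γ₂, γ₃) ∈ hG.toFinset := hG.mem_toFinset.2 ⟨hγ₁, hγ₂, hγ₃, hf₁, hf₂⟩
      by_cases hp₀ : p₀ ∈ F₀ (-(γ₁ + (γ₂ + γ₃)))
      swap
      · exact ih.step₀ hγ₁ hγ₂ hγ₃ hp (hF₀ _ p₀ hp₀ hw₀) hw₁ hw₂ hw₃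
      by_cases hp₁ : p₁ ∈ F₁ γ₁
      swap
      · exact ih.step₁ hγ₁ hγ₂ hγ₃ hp hw₀ (hF₁ _ p₁ hp₁ hw₁) hw₂ hw₃
      by_cases hp₂ : p₂ ∈ F₂ γ₂
      swap
      · exact ih.step₂ hγ₁ hγ₂ hγ₃ hp hw₀ hw₁ (hF₂ _ p₂ hp₂ hw₂) hw₃
      by_cases hp₃ : p₃ ∈ F₃ γ₃
      swap
      · exact ih.step₃ hγ₁ hγ₂ hγ₃ hp hw₀ hw₁ hw₂ (hF₃ _ p₃ hp₃ hw₃)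
      refine hNmem w₀ ?_ w₁ ?_ w₂ ?_ w₃ ?_ <;>
        refine Submodule.mem_iSup_of_mem (γ₁, γ₂, γ₃) (Submodule.mem_iSup_of_mem hg ?_)
      · exact Submodule.mem_iSup_of_mem p₀ (Submodule.mem_iSup_of_mem hp₀ hw₀)
      · exact Submodule.mem_iSup_of_mem p₁ (Submodule.mem_iSup_of_mem hp₁ hw₁)
      · exact Submodule.mem_iSup_of_mem p₂ (Submodule.mem_iSup_of_mem hp₂ hw₂)
      · exact Submodule.mem_iSup_of_mem p₃ (Submodule.mem_iSup_of_mem hp₃ hw₃)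
  have hhom : ∀ p₀ p₁ p₂ p₃ : ℂ, ∀ w₀ ∈ M₀.wt p₀ ⊓ M₀.gr β₀, ∀ w₁ ∈ M₁.wt p₁ ⊓ M₁.gr β₁,
      ∀ w₂ ∈ M₂.wt p₂ ⊓ M₂.gr β₂, ∀ w₃ ∈ M₃.wt p₃ ⊓ M₃.gr β₃,
        matrixMap h₁ h₂ w₀ w₁ w₂ w₃ ∈ N := by
    intro p₀ p₁ p₂ p₃
    obtain ⟨n, hn⟩ := exists_nat_gt ((p₀ + p₁ + p₂ + p₃).re - r)
    have hz : ∀ β : At, β - β ∈ A₀ := fun β => by rw [sub_self]; exact A₀.zero_mem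
    exact hall n β₀ β₁ β₂ β₃ (hz _) (hz _) (hz _) p₀ p₁ p₂ p₃ (by linarith)
  refine ⟨N, hN, fun w₀ hw₀ w₁ hw₁ w₂ hw₂ w₃ hw₃ => ?_⟩
  rw [M₀.gr_compatible] at hw₀
  rw [M₁.gr_compatible] at hw₁
  rw [M₂.gr_compatible] at hw₂
  rw [M₃.gr_compatible] at hw₃
  suffices h : (⨆ p, M₀.wt p ⊓ M₀.gr β₀) ≤ (complexSubmodule N).comap
    ((((matrixMap h₁ h₂).flip w₁).flip w₂).flip w₃) from h hw₀
  refine iSup_le fun p₀ w₀ hw₀ => ?_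
  suffices h : (⨆ p, M₁.wt p ⊓ M₁.gr β₁) ≤ (complexSubmodule N).comap
    (((matrixMap h₁ h₂ w₀).flip w₂).flip w₃) from h hw₁
  refine iSup_le fun p₁ w₁ hw₁ => ?_
  suffices h : (⨆ p, M₂.wt p ⊓ M₂.gr β₂) ≤ (complexSubmodule N).comap
    ((matrixMap h₁ h₂ w₀ w₁).flip w₃) from h hw₂
  refine iSup_le fun p₂ w₂ hw₂ => ?_
  suffices h : (⨆ p, M₃.wt p ⊓ M₃.gr β₃) ≤ (complexSubmodule N).comap
    (matrixMap h₁ h₂ w₀ w₁ w₂) from h hw₃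
  exact iSup_le fun p₃ w₃ hw₃ => hhom p₀ p₁ p₂ p₃ w₀ hw₀ w₁ hw₁ w₂ hw₂ w₃ hw₃

theorem L_neg_one_iterate_mem {W : Type*} [AddCommGroup W] [Module ℂ W]
    (M : StronglyGradedGenModule 𝒱 W) {β : At} {w : W} (hw : w ∈ M.gr β) (n : ℕ) :
    (vir M.Y 𝒱.ω (-1))^[n] w ∈ M.gr β := by
  induction n with
  | zero => exact hw
  | succ n ih =>
    rw [Function.iterate_succ_apply']
    simpa [vir] using M.gr_Y 0 β (-1 + 1) 𝒱.ω 𝒱.ω_mem_gr _ ih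

end FiniteGeneration

end

end VertexAlg

theorem theorem5p5
    {At : Type*} [AddCommGroup At] (A A₀ : AddSubgroup At) (hA₀ : A₀ ≤ A)
    {V : Type*} [AddCommGroup V] [Module ℂ V] (𝒱 : StronglyGradedCVA A V)
    (V₀ : Submodule ℂ V) (hV₀ : IsStronglyGradedSubalgebra 𝒱 A₀ V₀)
    {W₀ W₁ W₂ W₃ W₄ : Type*}
    [AddCommGroup W₀] [Module ℂ W₀] [AddCommGroup W₁] [Module ℂ W₁]
    [AddCommGroup W₂] [Module ℂ W₂] [AddCommGroup W₃] [Module ℂ W₃]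
    [AddCommGroup W₄] [Module ℂ W₄]
    (M₀ : StronglyGradedGenModule 𝒱 W₀) (M₁ : StronglyGradedGenModule 𝒱 W₁)
    (M₂ : StronglyGradedGenModule 𝒱 W₂) (M₃ : StronglyGradedGenModule 𝒱 W₃)
    (M₄ : StronglyGradedGenModule 𝒱 W₄)
    (hM₀ : M₀.RealGraded ∧ M₀.LowerBounded ∧ M₀.C₁Cofinite V₀)
    (hM₁ : M₁.RealGraded ∧ M₁.LowerBounded ∧ M₁.C₁Cofinite V₀)
    (hM₂ : M₂.RealGraded ∧ M₂.LowerBounded ∧ M₂.C₁Cofinite V₀)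
    (hM₃ : M₃.RealGraded ∧ M₃.LowerBounded ∧ M₃.C₁Cofinite V₀)
    (hF₁ : FiniteFusion A₀ M₁.toGradedAction M₄.toGradedAction (contragredient M₀))
    (hF₂ : FiniteFusion A₀ M₂.toGradedAction M₃.toGradedAction M₄.toGradedAction)
    (𝒴₁ : LogModes W₁ W₄ ↥(restrictedDual M₀)) (𝒴₂ : LogModes W₂ W₃ W₄)
    (h𝒴₁ : IsGradedLogIntertwining M₁.toGradedAction M₄.toGradedAction (contragredient M₀) 𝒴₁)
    (h𝒴₂ : IsGradedLogIntertwining M₂.toGradedAction M₃.toGradedAction M₄.toGradedAction 𝒴₂)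
    (β₀ β₁ β₂ β₃ : At) (w₀ : W₀) (w₁ : W₁) (w₂ : W₂) (w₃ : W₃)
    (hw₀ : w₀ ∈ M₀.gr β₀) (hw₁ : w₁ ∈ M₁.gr β₁) (hw₂ : w₂ ∈ M₂.gr β₂) (hw₃ : w₃ ∈ M₃.gr β₃) :
    ∃ (m n : ℕ) (a b : ℕ → CoeffRing), 1 ≤ m ∧ 1 ≤ n ∧
      SatisfiesODE partial₁ m a (matrixElement M₀ 𝒴₁ 𝒴₂ w₀ w₁ w₂ w₃) ∧
      SatisfiesODE partial₂ n b (matrixElement M₀ 𝒴₁ 𝒴₂ w₀ w₁ w₂ w₃) := by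
  obtain ⟨N, hN, hmem⟩ := exists_fg_matrixMap_mem hV₀ hM₀.2.1 hM₁.2.1 hM₂.2.1 hM₃.2.1
    hM₀.2.2 hM₁.2.2 hM₂.2.2 hM₃.2.2 hF₁ hF₂ h𝒴₁ h𝒴₂ β₀ β₁ β₂ β₃
  have h₁ := h𝒴₁.toIsLogIntertwining
  have h₂ := h𝒴₂.toIsLogIntertwining
  have d₁ : ∀ n : ℕ, partial₁^[n] (matrixElement M₀ 𝒴₁ 𝒴₂ w₀ w₁ w₂ w₃)
      = matrixElement M₀ 𝒴₁ 𝒴₂ w₀ ((vir M₁.Y 𝒱.ω (-1))^[n] w₁) w₂ w₃ := by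
    intro n
    induction n with
    | zero => rfl
    | succ n ih =>
      rw [Function.iterate_succ_apply', ih, ← matrixElement_L_neg_one₁ h₁,
        Function.iterate_succ_apply']
  have d₂ : ∀ n : ℕ, partial₂^[n] (matrixElement M₀ 𝒴₁ 𝒴₂ w₀ w₁ w₂ w₃)
      = matrixElement M₀ 𝒴₁ 𝒴₂ w₀ w₁ ((vir M₂.Y 𝒱.ω (-1))^[n] w₂) w₃ := by
    intro n
    induction n with
    | zero => rfl
    | succ n ih =>
      rw [Function.iterate_succ_apply', ih, ← matrixElement_L_neg_one₂ h₂,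
        Function.iterate_succ_apply']
  obtain ⟨m, a, hm, ha⟩ := exists_satisfiesODE hN (D := partial₁)
    (φ := matrixElement M₀ 𝒴₁ 𝒴₂ w₀ w₁ w₂ w₃)
    (fun n => hmem w₀ hw₀ _ (L_neg_one_iterate_mem M₁ hw₁ n) w₂ hw₂ w₃ hw₃)
    (fun n p q k l i j => by rw [d₁, lcoeff_matrixMap])
  obtain ⟨n, b, hn, hb⟩ := exists_satisfiesODE hN (D := partial₂)
    (φ := matrixElement M₀ 𝒴₁ 𝒴₂ w₀ w₁ w₂ w₃)
    (fun n => hmem w₀ hw₀ w₁ hw₁ _ (L_neg_one_iterate_mem M₂ hw₂ n) w₃ hw₃)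
    (fun n p q k l i j => by rw [d₂, lcoeff_matrixMap])
  exact ⟨m, n, a, b, hm, hn, ha, hb⟩
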